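/- Fix integers $k,N\ge 1$. Partition diagrams are drawn in the English convention (rows numbered from north to south, columns from west to east). The content of the cell in row $i$ and column $j$ is $j-i$. A *skew shape with contents* is an equivalence class of skew shapes $\lambda/\mu$ ($\mu\subseteq\lambda$ partitions), two skew shapes being equivalent if there is a content and order preserving bijection between their diagrams. Let $\bm\beta=(\beta^{(0)},\dots,\beta^{(k-1)})$ be a $k$-tuple of skew shapes with contents. The *shifted content* of a cell $z\in\beta^{(i)}$ is $\tilde c(z)=k\,c(z)+i$, where $c(z)$ is its content. Assume that no $\beta^{(i)}$ contains a $2\times2$ square and that all shifted contents of $\bm\beta$ lie in $\{1,\dots,N\}$. Let $\mathcal U=\mathbb Z\langle u_1,\dots,u_N\rangle$ and $\mathcal U_q=\mathbb Q(q)\otimes_{\mathbb Z}\mathcal U$. Their monomials are identified with words in the alphabet $\{1,\dots,N\}$, with $u_a$ written $\mathsf a$. Let $\langle\cdot,\cdot\rangle$ be the symmetric bilinear form on $\mathcal U_q$ for which the words are an orthonormal basis, and let $I^\perp=\{f\in\mathcal U_q: \langle z,f\rangle=0\text{ for all }z\in I\}$ for a two-sided ideal $I$. Let $J_k$ be the two-sided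 ideal of $\mathcal U_q$ generated by the relations - $\mathsf{ac}=\mathsf{ca}$ for $c-a>k$, - $\mathsf{ab}=q^{-1}\mathsf{ba}$ for $0<b-a<k$, - $\mathsf w=0$ for all words $\mathsf w$ with a repeated letter. Let $W_k(\bm\beta)$ be the set of words $v$ without repeated letters that are rearrangements of the shifted contents of $\bm\beta$ and such that, for each $i$ and all cells $z,z'$ of $\beta^{(i)}$ with $z'$ immediately east or south of $z$, the letter $\tilde c(z)$ occurs before $\tilde c(z')$ in $v$. For a word $v=v_1\cdots v_n$ let $\mathrm{inv}_k(v)=|\{(i,j): i<j,\ 0<v_i-v_j<k\}|$, let $\mathrm{Des}(v)=\{i\in\{1,\dots,n-1\}: v_i>v_{i+1}\}$, and let $$Q_{\mathrm{Des}(v)}(\mathbf x)=\sum_{\substack{1\le i_1\le\cdots\le i_n\\ j\in \mathrm{Des}(v)\Rightarrow i_j<i_{j+1}}}x_{i_1}\cdots x_{i_n}$$ be Gessel's fundamental quasisymmetric function. Let $\Delta$ be the $\mathbb Q(q)$-linear map on $\mathcal U_q$ with $\Delta(v)=Q_{\mathrm{Des}(v)}(\mathbf x)$ for all words $v$. The new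 variant combinatorial LLT polynomial indexed by $\bm\beta$ is, by definition, $$\mathcal G_{\bm\beta}(\mathbf x;q)=\sum_{v\in W_k(\bm\beta)}q^{\mathrm{inv}_k(v)}Q_{\mathrm{Des}(v)}(\mathbf x),$$ and the new variant $q$-Littlewood–Richardson coefficients $\mathfrak c^\lambda_{\bm\beta}(q)\in\mathbb Q(q)$ are the coefficients of its expansion in Schur functions, $\mathcal G_{\bm\beta}(\mathbf x;q)=\sum_\lambda\mathfrak c^\lambda_{\bm\beta}(q)\,s_\lambda(\mathbf x)$. Let $e_d(\mathbf u)=\sum_{N\ge i_1>\cdots>i_d\ge1}u_{i_1}\cdots u_{i_d}$ for $d\ge1$, $e_0(\mathbf u)=1$, and $e_d(\mathbf u)=0$ for $d<0$. For a partition $\lambda$ with conjugate $\lambda'=(\lambda'_1,\dots,\lambda'_t)$, $t=\lambda_1$, let $$\mathfrak J_\lambda(\mathbf u)=\sum_{\pi\in S_t}\mathrm{sgn}(\pi)\,e_{\lambda'_1+\pi(1)-1}(\mathbf u)\,e_{\lambda'_2+\pi(2)-2}(\mathbf u)\cdots e_{\lambda'_t+\pi(t)-t}(\mathbf u).$$ **Proposition.**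 Let $f=\sum_{v\in W_k(\bm\beta)}q^{\mathrm{inv}_k(v)}\,v\in\mathcal U_q$. Then $f\in J_k^\perp$ and $\mathcal G_{\bm\beta}(\mathbf x;q)=\Delta(f)$. Moreover, the expansion of $\mathcal G_{\bm\beta}(\mathbf x;q)$ in Schur functions exists and is unique, and $\mathfrak c^\lambda_{\bm\beta}(q)=\langle\mathfrak J_\lambda(\mathbf u),f\rangle$ for every partition $\lambda$. -/

import Mathlib

noncomputable section

/-! ### Skew shapes with contents -/

/-- A skew shape `outer / inner`, where `inner ⊆ outer` are partitions (English convention: the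
cell `(i, j)` lies in row `i`, counted from north to south, and in column `j`, counted from west
to east; both indices start at `0`). -/
structure SkewShape where
  outer : YoungDiagram
  inner : YoungDiagram
  inner_le : inner ≤ outer

namespace SkewShape

/-- The diagram of a skew shape. -/
def cells (s : SkewShape) : Finset (ℕ × ℕ) := s.outer.cells \ s.inner.cells

/-- The content `j - i` of the cell `(i, j)`. -/
def content (z : ℕ × ℕ) : ℤ := (z.2 : ℤ) - (z.1 : ℤ)

/-- Two skew shapes are equivalent if there is a content and order preserving bijection between
their diagrams, which are ordered as subsets of `ℕ × ℕ`. -/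
def Equivalent (s t : SkewShape) : Prop :=
  ∃ e : s.cells ≃o t.cells, ∀ z : s.cells, content (e z : ℕ × ℕ) = content (z : ℕ × ℕ)

instance setoid : Setoid SkewShape where
  r := Equivalent
  iseqv :=
    { refl := fun s => ⟨OrderIso.refl _, fun _ => rfl⟩
      symm := by
        rintro s t ⟨e, he⟩
        refine ⟨e.symm, fun z => ?_⟩
        have h := he (e.symm z)
        rw [OrderIso.apply_symm_apply] at h
        exact h.symm
      trans := by
        rintro s t r ⟨e, he⟩ ⟨f, hf⟩
        refine ⟨e.trans f, fun z => ?_⟩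
        rw [OrderIso.trans_apply, hf, he] }

/-- The multiset of contents of the cells of a skew shape. -/
def contents (s : SkewShape) : Multiset ℤ := s.cells.val.map content

/-- The cell `z'` lies immediately east of `z`. -/
def East (z z' : ℕ × ℕ) : Prop := z'.1 = z.1 ∧ z'.2 = z.2 + 1

/-- The cell `z'` lies immediately south of `z`. -/
def South (z z' : ℕ × ℕ) : Prop := z'.1 = z.1 + 1 ∧ z'.2 = z.2

/-- The pairs `(c(z), c(z'))`, where `z, z'` are cells such that `z'` lies immediately east or
south of `z`. -/
def neighbours (s : SkewShape) : Set (ℤ × ℤ) :=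
  {p | ∃ z ∈ s.cells, ∃ z' ∈ s.cells, (East z z' ∨ South z z') ∧ p = (content z, content z')}

/-- The diagram contains a `2 × 2` square. -/
def HasSquare (s : SkewShape) : Prop :=
  ∃ i j : ℕ, (i, j) ∈ s.cells ∧ (i, j + 1) ∈ s.cells ∧ (i + 1, j) ∈ s.cells ∧
    (i + 1, j + 1) ∈ s.cells

theorem mem_cells_of_between (s : SkewShape) {a b c : ℕ × ℕ} (ha : a ∈ s.cells)
    (hc : c ∈ s.cells) (hab : a ≤ b) (hbc : b ≤ c) : b ∈ s.cells := by
  simp only [cells, Finset.mem_sdiff] at ha hc ⊢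
  exact ⟨s.outer.isLowerSet hbc hc.1, fun h => ha.2 (s.inner.isLowerSet hab h)⟩

theorem hasSquare_iff (s : SkewShape) : s.HasSquare ↔
    ∃ z z' : s.cells, z < z' ∧ content (z : ℕ × ℕ) = content (z' : ℕ × ℕ) := by
  constructor
  · rintro ⟨i, j, h1, -, -, h4⟩
    refine ⟨⟨(i, j), h1⟩, ⟨(i + 1, j + 1), h4⟩, ?_, ?_⟩
    · rw [← Subtype.coe_lt_coe, Prod.lt_iff]
      left
      constructor
      · show i < i + 1
        omega
      · show j ≤ j + 1
        omega
    · simp [content]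
  · rintro ⟨⟨⟨i, j⟩, hz⟩, ⟨⟨i', j'⟩, hz'⟩, hlt, hc⟩
    rw [← Subtype.coe_lt_coe, Prod.lt_iff] at hlt
    simp only [content] at hlt hc
    refine ⟨i, j, hz, ?_, ?_, ?_⟩ <;> refine s.mem_cells_of_between hz hz' ?_ ?_ <;>
      rw [Prod.le_def] <;> constructor <;> simp only <;> omega

theorem east_iff (s : SkewShape) (z z' : s.cells) : East (z : ℕ × ℕ) (z' : ℕ × ℕ) ↔
    z ⋖ z' ∧ content (z' : ℕ × ℕ) = content (z : ℕ × ℕ) + 1 := by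
  obtain ⟨⟨i, j⟩, hz⟩ := z
  obtain ⟨⟨i', j'⟩, hz'⟩ := z'
  constructor
  · rintro ⟨h1, h2⟩
    simp only at h1 h2
    refine ⟨⟨?_, ?_⟩, ?_⟩
    · rw [← Subtype.coe_lt_coe, Prod.lt_iff]
      simp only
      omega
    · rintro ⟨⟨a, b⟩, hy⟩ h3 h4
      rw [← Subtype.coe_lt_coe, Prod.lt_iff] at h3 h4
      simp only at h3 h4
      omega
    · simp only [content]
      omega
  · rintro ⟨⟨hlt, hcov⟩, hc⟩
    have hlt' := hlt
    rw [← Subtype.coe_lt_coe, Prod.lt_iff] at hlt'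
    simp only [content] at hlt' hc
    by_contra hne
    simp only [East] at hne
    have hy : (i, j + 1) ∈ s.cells := by
      refine s.mem_cells_of_between hz hz' ?_ ?_ <;>
        rw [Prod.le_def] <;> constructor <;> simp only <;> omega
    refine hcov (c := ⟨(i, j + 1), hy⟩) ?_ ?_ <;>
      rw [← Subtype.coe_lt_coe, Prod.lt_iff] <;> simp only <;> omega

theorem south_iff (s : SkewShape) (z z' : s.cells) : South (z : ℕ × ℕ) (z' : ℕ × ℕ) ↔
    z ⋖ z' ∧ content (z' : ℕ × ℕ) = content (z : ℕ × ℕ) - 1 := by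
  obtain ⟨⟨i, j⟩, hz⟩ := z
  obtain ⟨⟨i', j'⟩, hz'⟩ := z'
  constructor
  · rintro ⟨h1, h2⟩
    simp only at h1 h2
    refine ⟨⟨?_, ?_⟩, ?_⟩
    · rw [← Subtype.coe_lt_coe, Prod.lt_iff]
      simp only
      omega
    · rintro ⟨⟨a, b⟩, hy⟩ h3 h4
      rw [← Subtype.coe_lt_coe, Prod.lt_iff] at h3 h4
      simp only at h3 h4
      omega
    · simp only [content]
      omega
  · rintro ⟨⟨hlt, hcov⟩, hc⟩
    have hlt' := hlt
    rw [← Subtype.coe_lt_coe, Prod.lt_iff] at hlt'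
    simp only [content] at hlt' hc
    by_contra hne
    simp only [South] at hne
    have hy : (i + 1, j) ∈ s.cells := by
      refine s.mem_cells_of_between hz hz' ?_ ?_ <;>
        rw [Prod.le_def] <;> constructor <;> simp only <;> omega
    refine hcov (c := ⟨(i + 1, j), hy⟩) ?_ ?_ <;>
      rw [← Subtype.coe_lt_coe, Prod.lt_iff] <;> simp only <;> omega

theorem contents_congr (s t : SkewShape) (h : s ≈ t) : s.contents = t.contents := by
  obtain ⟨e, he⟩ := h
  have key : ∀ r : SkewShape, r.contents =
      (Finset.univ : Finset r.cells).val.map (fun z : r.cells => content z.1) := by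
    intro r
    have h2 : (Finset.univ : Finset r.cells).val.map Subtype.val = r.cells.val :=
      Multiset.attach_map_val _
    rw [contents, ← h2, Multiset.map_map]
    rfl
  rw [key s, key t, ← Finset.map_univ_equiv e.toEquiv, Finset.map_val, Multiset.map_map]
  exact Multiset.map_congr rfl fun z _ => (he z).symm

theorem neighbours_subset (s t : SkewShape) (h : s ≈ t) : s.neighbours ⊆ t.neighbours := by
  obtain ⟨e, he⟩ := h
  rintro p ⟨z, hz, z', hz', hor, rfl⟩
  refine ⟨e ⟨z, hz⟩, (e ⟨z, hz⟩).2, e ⟨z', hz'⟩, (e ⟨z', hz'⟩).2, ?_, by rw [he, he]⟩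
  rcases hor with h | h
  · left
    have h' := (s.east_iff ⟨z, hz⟩ ⟨z', hz'⟩).1 h
    exact (t.east_iff _ _).2 ⟨(apply_covBy_apply_iff e).2 h'.1, by rw [he, he]; exact h'.2⟩
  · right
    have h' := (s.south_iff ⟨z, hz⟩ ⟨z', hz'⟩).1 h
    exact (t.south_iff _ _).2 ⟨(apply_covBy_apply_iff e).2 h'.1, by rw [he, he]; exact h'.2⟩

theorem neighbours_congr (s t : SkewShape) (h : s ≈ t) : s.neighbours = t.neighbours :=
  Set.Subset.antisymm (neighbours_subset s t h) (neighbours_subset t s (Setoid.symm h))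

theorem hasSquare_of_equiv (s t : SkewShape) (h : s ≈ t) (hs : s.HasSquare) : t.HasSquare := by
  obtain ⟨e, he⟩ := h
  obtain ⟨z, z', hlt, hc⟩ := s.hasSquare_iff.1 hs
  exact t.hasSquare_iff.2 ⟨e z, e z', e.lt_iff_lt.2 hlt, by rw [he, he, hc]⟩

theorem hasSquare_congr (s t : SkewShape) (h : s ≈ t) : s.HasSquare = t.HasSquare :=
  propext ⟨hasSquare_of_equiv s t h, hasSquare_of_equiv t s (Setoid.symm h)⟩

end SkewShape

/-- A skew shape with contents: a skew shape up to content and order preserving bijections of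
diagrams. -/
def SkewShapeWithContents : Type := Quotient SkewShape.setoid

namespace SkewShapeWithContents

/-- The multiset of contents of the cells. -/
def contents (b : SkewShapeWithContents) : Multiset ℤ :=
  Quotient.lift SkewShape.contents SkewShape.contents_congr b

/-- The pairs `(c(z), c(z'))`, where `z, z'` are cells such that `z'` lies immediately east or
south of `z`. -/
def neighbours (b : SkewShapeWithContents) : Set (ℤ × ℤ) :=
  Quotient.lift SkewShape.neighbours SkewShape.neighbours_congr b

/-- The diagram contains a `2 × 2` square. -/
def HasSquare (b : SkewShapeWithContents) : Prop :=
  Quotient.lift SkewShape.HasSquare SkewShape.hasSquare_congr b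

end SkewShapeWithContents

/-! ### Words and the algebra of noncommutative polynomials -/

/-- Words in the alphabet `{1, …, N}`. The element `a : Fin N` stands for the letter `a + 1`. -/
abbrev Word (N : ℕ) : Type := FreeMonoid (Fin N)

/-- The letter in `{1, …, N}` for which an element of `Fin N` stands. -/
def letter {N : ℕ} (a : Fin N) : ℤ := (a : ℤ) + 1

/-- The free associative algebra `R⟨u_1, …, u_N⟩`, with the words as an `R`-basis. -/
abbrev NCPoly (R : Type) [CommRing R] (N : ℕ) : Type := MonoidAlgebra R (Word N)

/-- A word regarded as a monomial. -/
def monom (R : Type) [CommRing R] {N : ℕ} (w : Word N) : NCPoly R N := MonoidAlgebra.of R (Word N) w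

/-- The symmetric bilinear form for which the monomials form an orthonormal basis. -/
def wordPairing (R : Type) [CommRing R] (N : ℕ) : LinearMap.BilinForm R (NCPoly R N) :=
  LinearMap.mk₂ R (fun f g => f.coeff.sum fun w a => a * g.coeff w)
    (fun f f' g => by
      rw [MonoidAlgebra.coeff_add]
      exact Finsupp.sum_add_index' (fun _ => zero_mul _) (fun _ _ _ => add_mul _ _ _))
    (fun c f g => by
      rw [MonoidAlgebra.coeff_smul, Finsupp.sum_smul_index' (fun _ => zero_mul _),
        Finsupp.smul_sum]
      simp only [smul_eq_mul, mul_assoc])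
    (fun f g g' => by
      simp only [MonoidAlgebra.coeff_add, Finsupp.add_apply, mul_add]
      exact Finsupp.sum_add)
    (fun c f g => by
      simp only [MonoidAlgebra.coeff_smul, Finsupp.smul_apply, smul_eq_mul, Finsupp.mul_sum,
        mul_left_comm])

/-- The orthogonal complement of a two-sided ideal. -/
def orthogonalComplement {R : Type} [CommRing R] {N : ℕ} (I : TwoSidedIdeal (NCPoly R N)) :
    Submodule R (NCPoly R N) where
  carrier := {f | ∀ z ∈ I, wordPairing R N z f = 0}
  add_mem' := fun {f g} hf hg z hz => by rw [map_add, hf z hz, hg z hz, add_zero]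
  zero_mem' := fun _ _ => map_zero _
  smul_mem' := fun c f hf z hz => by rw [map_smul, hf z hz, smul_zero]

/-- The noncommutative elementary symmetric function `e_d(u)`: the sum of the monomials
`u_{i_1} ⋯ u_{i_d}` over all `i_1 > ⋯ > i_d`; it is `0` for `d < 0`. -/
def ncElem (R : Type) [CommRing R] (N : ℕ) (d : ℤ) : NCPoly R N :=
  if d < 0 then 0
  else ∑ S ∈ Finset.powersetCard d.toNat (Finset.univ : Finset (Fin N)),
    monom R (FreeMonoid.ofList (S.sort (· ≥ ·)))

/-- The noncommutative Schur function `𝔍_λ(u)`, by the Jacobi–Trudi formula in terms of the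
column lengths of `λ`. The factors are multiplied from left to right. -/
def ncSchur (R : Type) [CommRing R] (N : ℕ) (lam : YoungDiagram) : NCPoly R N :=
  ∑ p : Equiv.Perm (Fin (lam.rowLen 0)), (Equiv.Perm.sign p : ℤ) •
    (List.ofFn fun i : Fin (lam.rowLen 0) =>
      ncElem R N ((lam.colLen (i : ℕ) : ℤ) + ((p i : ℕ) : ℤ) - ((i : ℕ) : ℤ))).prod

/-! ### Quasisymmetric functions and Schur functions

Functions in the commuting variables `x_1, x_2, …` are power series in variables indexed by `ℕ`. -/

/-- The positions of the descents of a word (the positions of its letters are counted from `0`). -/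
def descents {N : ℕ} (w : Word N) : Set ℕ :=
  {i | ∃ h : i + 1 < w.toList.length, w.toList[i + 1] < w.toList[i]}

/-- Gessel's fundamental quasisymmetric function of degree `n` for a set `D` of descents (counted
from `0`): the sum of `x_{i_1} ⋯ x_{i_n}` over all weakly increasing `i_1, …, i_n` that increase
strictly at the elements of `D`. -/
def fundamentalQSym (R : Type) [CommRing R] (n : ℕ) (D : Set ℕ) : MvPowerSeries ℕ R :=
  fun m => (Set.ncard {i : Fin n → ℕ | Monotone i ∧
    (∀ j j' : Fin n, (j' : ℕ) = (j : ℕ) + 1 → (j : ℕ) ∈ D → i j < i j') ∧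
    ∑ j, Finsupp.single (i j) 1 = m} : R)

/-- The function `Q_{Des(w)}(x)` of a word `w`. -/
def wordQSym (R : Type) [CommRing R] {N : ℕ} (w : Word N) : MvPowerSeries ℕ R :=
  fundamentalQSym R w.toList.length (descents w)

/-- The linear map `Δ` that sends a word `w` to `Q_{Des(w)}(x)`. -/
def genFun (R : Type) [CommRing R] (N : ℕ) : NCPoly R N →ₗ[R] MvPowerSeries ℕ R :=
  (Finsupp.linearCombination R (fun w : Word N => wordQSym R w)).comp
    (MonoidAlgebra.coeffLinearEquiv R).toLinearMap

/-- The Schur function `s_λ(x)`, the sum of `x^T` over all semistandard Young tableaux `T` of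
shape `λ`. -/
def schurFun (R : Type) [CommRing R] (lam : YoungDiagram) : MvPowerSeries ℕ R :=
  fun m => (Set.ncard {T : SemistandardYoungTableau lam |
    ∑ c ∈ lam.cells, Finsupp.single (T c.1 c.2) 1 = m} : R)

/-! ### LLT polynomials -/

/-- The field `ℚ(q)`. -/
abbrev QField : Type := RatFunc ℚ

/-- The indeterminate `q`. -/
def qq : QField := RatFunc.X

/-- The shifted content `k c + i` of a cell of content `c` in the `i`-th skew shape. -/
def shifted (k : ℕ) (i : Fin k) (c : ℤ) : ℤ := (k : ℤ) * c + ((i : ℕ) : ℤ)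

/-- The multiset of shifted contents of a `k`-tuple of skew shapes with contents. -/
def shiftedContents {k : ℕ} (β : Fin k → SkewShapeWithContents) : Multiset ℤ :=
  ∑ i : Fin k, (β i).contents.map (shifted k i)

/-- No `β^{(i)}` contains a `2 × 2` square, and the shifted contents of `β` lie in
`{1, …, N}`. -/
def Admissible (N : ℕ) {k : ℕ} (β : Fin k → SkewShapeWithContents) : Prop :=
  (∀ i, ¬ (β i).HasSquare) ∧ ∀ c ∈ shiftedContents β, 1 ≤ c ∧ c ≤ (N : ℤ)

/-- The letter `a` occurs before the letter `b` in the word `v`. -/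
def OccursBefore {N : ℕ} (v : Word N) (a b : ℤ) : Prop :=
  ∃ p r : Fin v.toList.length, p < r ∧ letter (v.toList.get p) = a ∧ letter (v.toList.get r) = b

/-- The set of words `v` without repeated letters that are rearrangements of the shifted contents
of `β`, such that for cells `z, z'` of one and the same `β^{(i)}`, where `z'` lies immediately
east or south of `z`, the shifted content of `z` occurs before that of `z'`. -/
def lltWordSet (N : ℕ) {k : ℕ} (β : Fin k → SkewShapeWithContents) : Set (Word N) :=
  {v | v.toList.Nodup ∧ ((v.toList.map letter : List ℤ) : Multiset ℤ) = shiftedContents β ∧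
    ∀ i, ∀ p ∈ (β i).neighbours, OccursBefore v (shifted k i p.1) (shifted k i p.2)}

theorem lltWordSet_finite (N : ℕ) {k : ℕ} (β : Fin k → SkewShapeWithContents) :
    (lltWordSet N β).Finite := by
  refine (List.finite_length_eq (Fin N) (Multiset.card (shiftedContents β))).subset ?_
  intro v hv
  have h := hv.2.1
  show (FreeMonoid.toList v).length = _
  rw [← h, Multiset.coe_card, List.length_map]

/-- The words of `lltWordSet`, as a finite set. -/
def lltWords (N : ℕ) {k : ℕ} (β : Fin k → SkewShapeWithContents) : Finset (Word N) :=
  (lltWordSet_finite N β).toFinset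

/-- The number of pairs of positions `i < j` with `0 < v_i - v_j < k`. -/
def kInv (k : ℕ) {N : ℕ} (v : Word N) : ℕ :=
  (Finset.univ.filter fun p : Fin v.toList.length × Fin v.toList.length =>
    p.1 < p.2 ∧ 0 < letter (v.toList.get p.1) - letter (v.toList.get p.2) ∧
      letter (v.toList.get p.1) - letter (v.toList.get p.2) < (k : ℤ)).card

/-- The new variant combinatorial LLT polynomial indexed by `β`. -/
def lltPoly (N : ℕ) {k : ℕ} (β : Fin k → SkewShapeWithContents) : MvPowerSeries ℕ QField :=
  ∑ v ∈ lltWords N β, qq ^ kInv k v • wordQSym QField v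

/-- The element `f = ∑ q^{inv_k(v)} v` of `ℚ(q)⟨u_1, …, u_N⟩`. -/
def lltElement (N : ℕ) {k : ℕ} (β : Fin k → SkewShapeWithContents) : NCPoly QField N :=
  ∑ v ∈ lltWords N β, qq ^ kInv k v • monom QField v

/-- The family `c` consists of the coefficients of a Schur expansion of the LLT polynomial indexed
by `β`. -/
def IsQLRFamily (N : ℕ) {k : ℕ} (β : Fin k → SkewShapeWithContents)
    (c : YoungDiagram →₀ QField) : Prop :=
  lltPoly N β = c.sum fun lam a => a • schurFun QField lam

/-! ### The ideal of Lam's relations -/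

/-- The variable `u_a`. -/
def uVar {N : ℕ} (a : Fin N) : NCPoly QField N := monom QField (FreeMonoid.of a)

/-- The generators of the ideal: `u_a u_c - u_c u_a` for `c - a > k`, then
`u_a u_b - q⁻¹ u_b u_a` for `0 < b - a < k`, and the words with a repeated letter. -/
def lamRelations (k N : ℕ) : Set (NCPoly QField N) :=
  {x | ∃ a c : Fin N, letter c - letter a > (k : ℤ) ∧ x = uVar a * uVar c - uVar c * uVar a} ∪
  {x | ∃ a b : Fin N, 0 < letter b - letter a ∧ letter b - letter a < (k : ℤ) ∧
    x = uVar a * uVar b - qq⁻¹ • (uVar b * uVar a)} ∪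
  {x | ∃ w : Word N, ¬ w.toList.Nodup ∧ x = monom QField w}

/-- The two-sided ideal of `ℚ(q)⟨u_1, …, u_N⟩` generated by the relations. -/
def lamIdeal (k N : ℕ) : TwoSidedIdeal (NCPoly QField N) := TwoSidedIdeal.span (lamRelations k N)

end

noncomputable section

/-! Write `f` for `lltElement`. Its orthogonality to the ideal is checked on generators multiplied
by monomials on both sides, where it becomes a rule for the coefficients of `f` under exchange of
two adjacent letters. The order conditions on a word only involve letters that differ by exactly
`k`, because neighbouring cells have contents that differ by 1. An exchange of letters whose
difference is not `±k` therefore preserves the set of words, and it affects the inversion number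
only through the exchanged pair (`kInv_swap_of_far`, `kInv_swap_of_near`).

For the Schur expansion, let `e_d` and `h_d` be the sums of the strictly decreasing and the strictly
increasing products of `d` variables (`ncE`, `ncH`). For a word `v` without repeated letters, the
coefficient of `x^m` in its quasisymmetric function is 1 or 0 according to whether `v` is a
concatenation of increasing words of lengths `m_0, m_1, …`. This is also the coefficient of `v` in
`h_{m_0} h_{m_1} ⋯` (`wordQSym_apply`, `coeff_prod_ncH`). Hence the coefficient of `x^m` in the LLT
polynomial is the pairing of this product with `f`, which only depends on the product modulo the
ideal.

Modulo the ideal the `e_d` commute (`IsLamFamily.ncE_commute`), and the `h_d` are polynomials in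
them by the usual alternating relation (`IsLamFamily.sum_ncE_mul_ncH`). Commutative theory now
applies: the Pieri rule for dual Jacobi–Trudi determinants, iterated, writes `h_{m_0} h_{m_1} ⋯` as
the sum of the `𝔍_μ` weighted by Kostka numbers (`prod_H_eq_sum_kostka`, `lamProj_prod_ncH`).
Pairing with `f` shows that the numbers `⟨𝔍_μ, f⟩` are the coefficients of a Schur expansion, which
is finite by homogeneity. Uniqueness is the linear independence of Schur functions, a consequence of
the triangularity of Kostka numbers (`eq_zero_of_sum_smul_schurFun`). -/

open Finset in
/-- The elementary symmetric function of degree `d` in the noncommuting elements `u a`, `a ∈ S`. -/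
def ncE {α A : Type*} [LinearOrder α] [Ring A] (u : α → A) (S : Finset α) (d : ℕ) : A :=
  ∑ T ∈ powersetCard d S, ((T.sort (· ≥ ·)).map u).prod

open Finset in
/-- The sum of the strictly increasing products of `d` of the noncommuting elements `u a`,
`a ∈ S`. -/
def ncH {α A : Type*} [LinearOrder α] [Ring A] (u : α → A) (S : Finset α) (d : ℕ) : A :=
  ∑ T ∈ powersetCard d S, ((T.sort (· ≤ ·)).map u).prod

/-! ### Noncommutative elementary and complete symmetric functions -/

section NoncommutativeSymmetric

variable {α A : Type*} [LinearOrder α] [Ring A] (u : α → A)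

theorem sort_ge_eq_reverse (S : Finset α) : S.sort (· ≥ ·) = (S.sort (· ≤ ·)).reverse := by
  refine List.Perm.eq_of_pairwise' (r := (· ≥ ·)) (Finset.pairwise_sort _ _) ?_ ?_
  · rw [List.pairwise_reverse]
    exact Finset.pairwise_sort S (· ≤ ·)
  · refine List.Perm.trans ?_ (List.reverse_perm _).symm
    rw [← Multiset.coe_eq_coe, Finset.sort_eq, Finset.sort_eq]

theorem sort_ge_insert {a : α} {S : Finset α} (h : ∀ b ∈ S, a < b) :
    (insert a S).sort (· ≥ ·) = S.sort (· ≥ ·) ++ [a] := by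
  rw [sort_ge_eq_reverse, sort_ge_eq_reverse, Finset.sort_insert (· ≤ ·) (fun b hb => (h b hb).le)
    (fun ha => lt_irrefl _ (h a ha)), List.reverse_cons]

@[simp] theorem ncE_zero (S : Finset α) : ncE u S 0 = 1 := by simp [ncE]

@[simp] theorem ncH_zero (S : Finset α) : ncH u S 0 = 1 := by simp [ncH]

@[simp] theorem ncE_empty_succ (d : ℕ) : ncE u ∅ (d + 1) = 0 := by
  rw [ncE, Finset.powersetCard_eq_empty.2 (by simp), Finset.sum_empty]

@[simp] theorem ncH_empty_succ (d : ℕ) : ncH u ∅ (d + 1) = 0 := by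
  rw [ncH, Finset.powersetCard_eq_empty.2 (by simp), Finset.sum_empty]

theorem sum_powersetCard_insert {M : Type*} [AddCommMonoid M] {a : α} {S : Finset α} (ha : a ∉ S)
    (d : ℕ) (g : Finset α → M) :
    ∑ T ∈ Finset.powersetCard (d + 1) (insert a S), g T =
      ∑ T ∈ Finset.powersetCard (d + 1) S, g T +
        ∑ T ∈ Finset.powersetCard d S, g (insert a T) := by
  rw [Finset.powersetCard_succ_insert ha, Finset.sum_union, Finset.sum_image]
  · intro T hT T' hT' h
    rw [Finset.mem_coe, Finset.mem_powersetCard] at hT hT'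
    have h1 : a ∉ T := fun h => ha (hT.1 h)
    have h2 : a ∉ T' := fun h => ha (hT'.1 h)
    rw [← Finset.erase_insert h1, ← Finset.erase_insert h2, h]
  · rw [Finset.disjoint_left]
    intro T hT hT'
    rw [Finset.mem_image] at hT'
    obtain ⟨T', -, rfl⟩ := hT'
    exact ha ((Finset.mem_powersetCard.1 hT).1 (Finset.mem_insert_self _ _))

theorem ncE_insert {a : α} {S : Finset α} (h : ∀ b ∈ S, a < b) (d : ℕ) :
    ncE u (insert a S) (d + 1) = ncE u S (d + 1) + ncE u S d * u a := by
  have ha : a ∉ S := fun ha => lt_irrefl _ (h a ha)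
  rw [ncE, sum_powersetCard_insert ha, ncE, ncE, Finset.sum_mul]
  congr 1
  refine Finset.sum_congr rfl fun T hT => ?_
  rw [sort_ge_insert fun b hb => h b ((Finset.mem_powersetCard.1 hT).1 hb)]
  simp

theorem ncH_insert {a : α} {S : Finset α} (h : ∀ b ∈ S, a < b) (d : ℕ) :
    ncH u (insert a S) (d + 1) = ncH u S (d + 1) + u a * ncH u S d := by
  have ha : a ∉ S := fun ha => lt_irrefl _ (h a ha)
  rw [ncH, sum_powersetCard_insert ha, ncH, ncH, Finset.mul_sum]
  congr 1
  refine Finset.sum_congr rfl fun T hT => ?_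
  rw [Finset.sort_insert (· ≤ ·) (fun b hb => (h b ((Finset.mem_powersetCard.1 hT).1 hb)).le)
    (fun h' => ha ((Finset.mem_powersetCard.1 hT).1 h'))]
  simp

/-- The elements `u a` satisfy the consequences of Lam's relations that make the noncommutative
elementary symmetric functions commute. -/
structure IsLamFamily : Prop where
  mul_mul_self : ∀ a p, u a * p * u a = 0
  commutator : ∀ a m, a < m → u a * u m = u m * u a ∨
    ∀ b, a < b → b < m → (u a * u m - u m * u a) * u b = u b * (u a * u m - u m * u a)

variable {u}

/-- Moving `u a` to the right through a decreasing product leaves a commutator with `u m` in place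
of each factor `u m`. The factors after that place have indices strictly between `a` and `m`, so
they commute with the commutator, which can be moved to the right end. -/
theorem IsLamFamily.mul_ncE (hu : IsLamFamily u) (a : α) (S : Finset α) :
    (∀ b ∈ S, a < b) → ∀ d, u a * ncE u S (d + 1) = ncE u S (d + 1) * u a +
      ∑ m ∈ S, ncE u (S.erase m) d * (u a * u m - u m * u a) := by
  induction S using Finset.induction_on_min with
  | empty => intro _ d; simp
  | insert b S hb ih =>
    intro h d
    have hbS : b ∉ S := fun hb' => lt_irrefl _ (hb b hb')
    have ih := ih fun c hc => h c (Finset.mem_insert_of_mem hc)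
    have hab : a < b := h b (Finset.mem_insert_self _ _)
    rw [ncE_insert u hb, Finset.sum_insert hbS, Finset.erase_insert hbS, mul_add, ih, add_mul]
    have herase : ∀ m ∈ S, (insert b S).erase m = insert b (S.erase m) := fun m hm =>
      Finset.erase_insert_of_ne (ne_of_lt (hb m hm))
    have hmin : ∀ m, ∀ c ∈ S.erase m, b < c := fun m c hc => hb c (Finset.mem_of_mem_erase hc)
    have hcomm : ∀ m ∈ S, (u a * u m - u m * u a) * u b = u b * (u a * u m - u m * u a) := by
      intro m hm
      rcases hu.commutator a m (hab.trans (hb m hm)) with h0 | h0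
      · rw [h0]; simp
      · exact h0 b hab (hb m hm)
    rcases d with _ | d
    · have : ∑ m ∈ S, ncE u ((insert b S).erase m) 0 * (u a * u m - u m * u a) =
        ∑ m ∈ S, ncE u (S.erase m) 0 * (u a * u m - u m * u a) := by simp
      rw [this]
      simp only [ncE_zero, one_mul]
      abel
    · have : ∑ m ∈ S, ncE u ((insert b S).erase m) (d + 1) * (u a * u m - u m * u a) =
        ∑ m ∈ S, ncE u (S.erase m) (d + 1) * (u a * u m - u m * u a) +
          (∑ m ∈ S, ncE u (S.erase m) d * (u a * u m - u m * u a)) * u b := by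
        rw [Finset.sum_mul, ← Finset.sum_add_distrib]
        refine Finset.sum_congr rfl fun m hm => ?_
        rw [herase m hm, ncE_insert u (hmin m), add_mul, mul_assoc _ (u b), ← hcomm m hm,
          mul_assoc _ _ (u b)]
      rw [this, ← mul_assoc (u a), ih, add_mul, mul_assoc _ (u a)]
      simp only [mul_sub, mul_assoc]
      abel

/-- The terms that contain `u m` are killed by the factor `u m` on the right, whatever stands in
between. -/
theorem IsLamFamily.ncE_mul_mul (hu : IsLamFamily u) (m : α) (S : Finset α) :
    ∀ d p, ncE u S d * p * u m = ncE u (S.erase m) d * p * u m := by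
  induction S using Finset.induction_on_min with
  | empty => intro d p; simp
  | insert b S hb ih =>
    intro d p
    rcases d with _ | d
    · simp
    rw [ncE_insert u hb]
    rcases eq_or_ne b m with rfl | hbm
    · have hbS : b ∉ S := fun hb' => lt_irrefl _ (hb b hb')
      rw [Finset.erase_insert hbS, add_mul, add_mul, mul_assoc _ (u b) p,
        mul_assoc _ (u b * p) (u b), hu.mul_mul_self, mul_zero, add_zero]
    · rw [Finset.erase_insert_of_ne hbm,
        ncE_insert u fun c hc => hb c (Finset.mem_of_mem_erase hc), add_mul, add_mul, add_mul,
        add_mul, ih, mul_assoc _ (u b) p, ih, mul_assoc _ (u b) p]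

/-- Split off the least variable `u a` from both factors. The terms with two factors `u a` vanish,
and moving the remaining `u a` to the right produces commutator terms, in which `m` may be deleted
from both index sets. Everything left over is symmetric in `i` and `j` by induction, applied to the
smaller sets `S` and `S.erase m`. -/
theorem IsLamFamily.ncE_commute (hu : IsLamFamily u) (n : ℕ) :
    ∀ S : Finset α, S.card = n → ∀ i j, ncE u S i * ncE u S j = ncE u S j * ncE u S i := by
  induction n using Nat.strong_induction_on with
  | _ n ih =>
  intro S hS i j
  rcases S.eq_empty_or_nonempty with rfl | hne
  · rcases i with _ | i <;> rcases j with _ | j <;> simp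
  obtain ⟨a, S, h, rfl⟩ : ∃ a, ∃ S' : Finset α, (∀ b ∈ S', a < b) ∧ S = insert a S' :=
    ⟨S.min' hne, S.erase (S.min' hne), fun b hb => Finset.min'_lt_of_mem_erase_min' _ _ hb,
      (Finset.insert_erase (Finset.min'_mem _ _)).symm⟩
  have ha : a ∉ S := fun ha => lt_irrefl _ (h a ha)
  rw [Finset.card_insert_of_notMem ha] at hS
  rcases i with _ | i
  · simp
  rcases j with _ | j
  · simp
  have key : ∀ i j, ncE u (insert a S) (i + 1) * ncE u (insert a S) (j + 1) =
      ncE u S (i + 1) * ncE u S (j + 1) +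
        (ncE u S i * ncE u S (j + 1) + ncE u S (i + 1) * ncE u S j) * u a +
        ∑ m ∈ S, ncE u (S.erase m) i * ncE u (S.erase m) j * (u a * u m - u m * u a) := by
    intro i j
    have h1 : ncE u S i * (u a * ncE u S (j + 1)) = ncE u S i * ncE u S (j + 1) * u a +
        ∑ m ∈ S, ncE u (S.erase m) i * ncE u (S.erase m) j * (u a * u m - u m * u a) := by
      rw [hu.mul_ncE a S h, mul_add, Finset.mul_sum, mul_assoc]
      congr 1
      refine Finset.sum_congr rfl fun m _ => ?_
      have h2 := hu.ncE_mul_mul m S i (ncE u (S.erase m) j * u a)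
      have h3 := hu.ncE_mul_mul m S i (ncE u (S.erase m) j)
      simp only [← mul_assoc] at h2 h3
      rw [mul_sub, mul_sub, mul_sub]
      simp only [← mul_assoc]
      rw [h2, h3]
    rw [ncE_insert u h, ncE_insert u h, add_mul, mul_add, mul_assoc (ncE u S i), mul_add, mul_add,
      h1, ← mul_assoc (u a), ← mul_assoc (ncE u S i) (u a * _), ← mul_assoc (ncE u S i) (u a),
      mul_assoc (ncE u S i * u a)]
    have h4 : ncE u S i * u a * (ncE u S j * u a) = 0 := by
      rw [mul_assoc, ← mul_assoc (u a), hu.mul_mul_self, mul_zero]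
    rw [h4, add_mul, ← mul_assoc]
    abel
  rw [key, key, ih S.card (by omega) S rfl (i + 1), ih S.card (by omega) S rfl i (j + 1),
    ih S.card (by omega) S rfl (i + 1) j]
  have h5 : ∀ m ∈ S, ncE u (S.erase m) i * ncE u (S.erase m) j * (u a * u m - u m * u a) =
      ncE u (S.erase m) j * ncE u (S.erase m) i * (u a * u m - u m * u a) := by
    intro m hm
    rw [ih (S.erase m).card (by have := Finset.card_erase_lt_of_mem hm; omega) _ rfl i]
  rw [Finset.sum_congr rfl h5, add_comm (ncE u S j * ncE u S (i + 1))]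

/-- The generating polynomials are the products of the `1 - u b X` in decreasing order and of the `1
+ u b X` in increasing order. The factors of the least `b` meet in the middle and cancel because `u
b` has square zero, so the product telescopes to 1. -/
theorem IsLamFamily.sum_ncE_mul_ncH (hu : IsLamFamily u) (S : Finset α) :
    ∀ n, ∑ ij ∈ Finset.HasAntidiagonal.antidiagonal (n + 1),
      (-1 : A) ^ ij.1 * (ncE u S ij.1 * ncH u S ij.2) = 0 := by
  have hE : ∀ S : Finset α, ∃ P : Polynomial A, ∃ R : Polynomial A, P * R = 1 ∧
      (∀ d, P.coeff d = (-1) ^ d * ncE u S d) ∧ ∀ d, R.coeff d = ncH u S d := by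
    intro S
    induction S using Finset.induction_on_min with
    | empty =>
      refine ⟨1, 1, one_mul _, fun d => ?_, fun d => ?_⟩ <;> rcases d with _ | d <;>
        simp [Polynomial.coeff_one]
    | insert b S hb ih =>
      obtain ⟨P, R, h1, h2, h3⟩ := ih
      refine ⟨P * (1 - Polynomial.C (u b) * Polynomial.X),
        (1 + Polynomial.C (u b) * Polynomial.X) * R, ?_, fun d => ?_, fun d => ?_⟩
      · have h4 : (1 - Polynomial.C (u b) * Polynomial.X) *
            (1 + Polynomial.C (u b) * Polynomial.X) = 1 := by
          have h5 : Polynomial.C (u b) * Polynomial.X * (Polynomial.C (u b) * Polynomial.X) = 0 := by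
            rw [mul_assoc, ← mul_assoc Polynomial.X, Polynomial.X_mul_C, mul_assoc, ← mul_assoc,
              ← Polynomial.C_mul]
            have := hu.mul_mul_self b 1
            rw [mul_one] at this
            rw [this]
            simp
          rw [sub_mul, mul_add, mul_add, h5]
          simp
        rw [mul_assoc, ← mul_assoc _ _ R, h4, one_mul, h1]
      · rcases d with _ | d
        · simp [mul_sub, h2, ← mul_assoc]
        · rw [mul_sub, mul_one, Polynomial.coeff_sub, ← mul_assoc, Polynomial.coeff_mul_X,
            Polynomial.coeff_mul_C, h2, h2, ncE_insert u hb, pow_succ, mul_add, mul_assoc _ _ (u b)]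
          simp [sub_eq_add_neg]
      · rcases d with _ | d
        · simp [add_mul, h3, mul_assoc]
        · rw [add_mul, one_mul, Polynomial.coeff_add, mul_assoc, Polynomial.coeff_C_mul,
            Polynomial.coeff_X_mul, h3, h3, ncH_insert u hb]
  intro n
  obtain ⟨P, R, h1, h2, h3⟩ := hE S
  have h4 := congrArg (fun p => p.coeff (n + 1)) h1
  simp only [Polynomial.coeff_mul, h2, h3, Polynomial.coeff_one, mul_assoc] at h4
  simpa using h4

end NoncommutativeSymmetric


/-! ### Dual Jacobi–Trudi determinants and the Pieri rule -/

section DualJacobiTrudi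

open Matrix

/-- The `T × T` dual Jacobi–Trudi matrix of a sequence of column lengths. -/
def eMatrix {R : Type*} (E : ℤ → R) (T : ℕ) (γ : ℕ → ℕ) : Matrix (Fin T) (Fin T) R :=
  Matrix.of fun i j => E ((γ i : ℤ) + ((j : ℕ) : ℤ) - ((i : ℕ) : ℤ))

/-- The sequence `γ` with `1` added at the places in `s`. -/
def addIndicator {T : ℕ} (γ : ℕ → ℕ) (s : Finset (Fin T)) (i : ℕ) : ℕ :=
  γ i + if i ∈ s.map Fin.valEmbedding then 1 else 0

theorem addIndicator_val {T : ℕ} (γ : ℕ → ℕ) (s : Finset (Fin T)) (i : Fin T) :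
    addIndicator γ s i = γ i + if i ∈ s then 1 else 0 := by
  have h : (i : ℕ) ∈ s.map Fin.valEmbedding ↔ i ∈ s := by
    rw [← Fin.valEmbedding_apply, Finset.mem_map']
  simp only [addIndicator, h]

theorem eMatrix_congr {R : Type*} (E : ℤ → R) (T : ℕ) {γ δ : ℕ → ℕ} (h : ∀ i < T, γ i = δ i) :
    eMatrix E T γ = eMatrix E T δ := by
  ext i j
  simp only [eMatrix, Matrix.of_apply, h i i.2]

variable {R : Type*} [CommRing R]

theorem det_eq_of_last_row {T : ℕ} (M : Matrix (Fin (T + 1)) (Fin (T + 1)) R)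
    (h : ∀ j : Fin T, M (Fin.last T) j.castSucc = 0) (h1 : M (Fin.last T) (Fin.last T) = 1) :
    M.det = (M.submatrix Fin.castSucc Fin.castSucc).det := by
  rw [det_succ_row M (Fin.last T), Fin.sum_univ_castSucc, Finset.sum_eq_zero, zero_add, h1,
    Fin.succAbove_last]
  · simp [← two_mul]
  · intro j _
    rw [h]
    simp

/-- An empty column contributes the last row `(0, …, 0, 1)`. Thus all shapes under consideration can
be treated with matrices of one common size. -/
theorem det_eMatrix_succ (E : ℤ → R) (hneg : ∀ d < 0, E d = 0) (h0 : E 0 = 1) (T : ℕ)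
    (γ : ℕ → ℕ) (hγ : γ T = 0) : (eMatrix E (T + 1) γ).det = (eMatrix E T γ).det := by
  rw [det_eq_of_last_row]
  · rfl
  · intro j
    refine hneg _ ?_
    have := j.2
    simp [hγ]
  · simp [eMatrix, hγ, h0]

theorem det_eMatrix_of_le (E : ℤ → R) (hneg : ∀ d < 0, E d = 0) (h0 : E 0 = 1) {t T : ℕ}
    (h : t ≤ T) (γ : ℕ → ℕ) (hγ : ∀ i, t ≤ i → γ i = 0) :
    (eMatrix E T γ).det = (eMatrix E t γ).det := by
  induction T, h using Nat.le_induction with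
  | base => rfl
  | succ T hT ih => rw [det_eMatrix_succ E hneg h0 T γ (hγ T hT), ih]

/-- Both sides evaluate one determinant, that of the `(T + 1) × (T + 1)` matrix with its last row
replaced by powers of `-z`: the right side by Laplace expansion along this row, the left side by
column operations and multilinearity in the rows. -/
theorem sum_pow_mul_det_eMatrix (E : ℤ → R) (z : R) (T : ℕ) (γ : ℕ → ℕ) :
    ∑ s : Finset (Fin T), z ^ s.card * (eMatrix E T (addIndicator γ s)).det =
      ∑ j : Fin (T + 1), z ^ (T - j : ℕ) *
        ((eMatrix E (T + 1) γ).submatrix Fin.castSucc j.succAbove).det := by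
  set N : Matrix (Fin (T + 1)) (Fin (T + 1)) R :=
    (eMatrix E (T + 1) γ).updateRow (Fin.last T) fun j => (-z) ^ (T - j : ℕ) with hN
  -- Right multiplication by `B` adds `z` times the next column to every column but the last. The
  -- last row becomes `(0, …, 0, 1)`, and row `i` becomes the row for `γ i` plus `z` times the row
  -- for `γ i + 1`, since raising `γ i` by 1 shifts the row by one column.
  set B : Matrix (Fin (T + 1)) (Fin (T + 1)) R :=
    Matrix.of fun i j => if i = j then 1 else if (i : ℕ) = j + 1 then z else 0 with hB
  have hBdet : B.det = 1 := by
    rw [det_of_isLowerTriangular]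
    · simp [hB]
    · intro i j hij
      have hij : i < j := hij
      rw [hB, Matrix.of_apply, if_neg hij.ne, if_neg]
      rw [Fin.lt_def] at hij
      omega
  have hNB : ∀ i, ∀ j : Fin T, (N * B) i j.castSucc = N i j.castSucc + z * N i j.succ := by
    intro i j
    rw [Matrix.mul_apply, Finset.sum_eq_add j.castSucc j.succ]
    · simp [hB, mul_comm]
      intro h
      simp [Fin.ext_iff] at h
    · simp [Fin.ext_iff]
    · intro c _ hc
      rw [hB, Matrix.of_apply, if_neg hc.1, if_neg, mul_zero]
      intro h
      exact hc.2 (Fin.ext h)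
    · simp
    · simp
  have hNB' : ∀ i, (N * B) i (Fin.last T) = N i (Fin.last T) := by
    intro i
    rw [Matrix.mul_apply, Finset.sum_eq_single (Fin.last T)]
    · simp [hB]
    · intro c _ hc
      rw [hB, Matrix.of_apply, if_neg hc, if_neg, mul_zero]
      have := c.2
      simp only [Fin.val_last]
      omega
    · simp
  have h1 : N.det = ((N * B).submatrix Fin.castSucc Fin.castSucc).det := by
    rw [← det_eq_of_last_row, det_mul, hBdet, mul_one]
    · intro j
      rw [hNB, hN, updateRow_self]
      have : T - (j : ℕ) = T - (j + 1 : ℕ) + 1 := by have := j.2; omega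
      simp only [Fin.val_castSucc, Fin.val_succ, this, pow_succ]
      ring
    · rw [hNB', hN, updateRow_self]
      simp
  have h2 : (N * B).submatrix Fin.castSucc Fin.castSucc =
      (fun i j : Fin T => z * E ((γ i : ℤ) + 1 + ((j : ℕ) : ℤ) - ((i : ℕ) : ℤ))) +
        (fun i j : Fin T => E ((γ i : ℤ) + ((j : ℕ) : ℤ) - ((i : ℕ) : ℤ))) := by
    ext i j
    rw [submatrix_apply, hNB, hN, updateRow_ne (Fin.castSucc_ne_last i), add_comm]
    simp only [eMatrix, Matrix.of_apply, Fin.val_castSucc, Fin.val_succ, Pi.add_apply]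
    congr 3
    push_cast
    ring
  have h3 : N.det = ∑ j : Fin (T + 1), z ^ (T - j : ℕ) *
        ((eMatrix E (T + 1) γ).submatrix Fin.castSucc j.succAbove).det := by
    rw [det_succ_row N (Fin.last T)]
    refine Finset.sum_congr rfl fun j _ => ?_
    rw [hN, updateRow_self, Fin.succAbove_last]
    congr 1
    · have : T + (j : ℕ) = 2 * j + (T - j : ℕ) := by have := j.2; omega
      rw [Fin.val_last, this, pow_add, pow_mul, neg_one_sq, one_pow, one_mul, ← mul_pow]
      simp
    · congr 1
      ext i k
      rw [submatrix_apply, submatrix_apply, updateRow_ne (Fin.castSucc_ne_last i)]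
  rw [← h3, h1, h2]
  have h4 := (detRowAlternating (R := R) (n := Fin T)).toMultilinearMap.map_add_univ
    (fun i j : Fin T => z * E ((γ i : ℤ) + 1 + ((j : ℕ) : ℤ) - ((i : ℕ) : ℤ)))
    (fun i j : Fin T => E ((γ i : ℤ) + ((j : ℕ) : ℤ) - ((i : ℕ) : ℤ)))
  refine Eq.trans ?_ h4.symm
  refine Finset.sum_congr rfl fun s _ => ?_
  have h5 : ∏ i : Fin T, (if i ∈ s then z else 1) = z ^ s.card := by
    rw [Finset.prod_ite_mem, Finset.univ_inter, Finset.prod_const]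
  rw [← h5, ← det_mul_column]
  refine congrArg det ?_
  ext i j
  simp only [eMatrix, Matrix.of_apply, addIndicator_val, Finset.piecewise]
  split_ifs with h
  · push_cast
    rfl
  · simp

/-- Compare coefficients of `X ^ m` in the preceding identity over the polynomial ring, with `z =
X`. -/
theorem sum_det_eMatrix_addIndicator (E : ℤ → R) (T m : ℕ) (hm : m ≤ T) (γ : ℕ → ℕ) :
    ∑ s ∈ Finset.powersetCard m (Finset.univ : Finset (Fin T)),
      (eMatrix E T (addIndicator γ s)).det =
      ((eMatrix E (T + 1) γ).submatrix Fin.castSucc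
        (⟨T - m, by omega⟩ : Fin (T + 1)).succAbove).det := by
  have h := sum_pow_mul_det_eMatrix (fun d => Polynomial.C (E d)) Polynomial.X T γ
  have hC : ∀ {n : ℕ} (M : Matrix (Fin n) (Fin n) R),
      (M.map Polynomial.C).det = Polynomial.C M.det := fun M =>
    (RingHom.map_det Polynomial.C M).symm
  have h1 : ∀ T γ, eMatrix (fun d => Polynomial.C (E d)) T γ = (eMatrix E T γ).map Polynomial.C :=
    fun T γ => rfl
  simp only [h1, submatrix_map, hC] at h
  have h2 := congrArg (fun p => Polynomial.coeff p m) h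
  simp only [Polynomial.finsetSum_coeff, Polynomial.coeff_X_pow_mul', Polynomial.coeff_C] at h2
  rw [Finset.sum_eq_single (⟨T - m, by omega⟩ : Fin (T + 1))] at h2
  · rw [if_pos (by simp only; omega), if_pos (by simp only; omega)] at h2
    rw [← h2, Finset.powersetCard_eq_filter, Finset.powerset_univ, Finset.sum_filter]
    refine Finset.sum_congr rfl fun s _ => ?_
    split_ifs <;> first | rfl | omega
  · intro j _ hj
    have hj' : (j : ℕ) ≠ T - m := fun h => hj (Fin.ext h)
    have := j.2
    split_ifs <;> first | rfl | omega
  · simp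

/-- By the preceding lemma the sum is the minor that omits the last row and column `T - m`. That
minor is, up to sign, the determinant with the unit vector at `T - m` as last row, and this unit
vector is a combination of the rows of the matrix in which the last row has coefficient `± H m`. -/
theorem sum_det_eMatrix_addIndicator_eq_mul (E : ℤ → R) (hneg : ∀ d < 0, E d = 0) (h0 : E 0 = 1)
    (H : ℕ → R) (hH0 : H 0 = 1)
    (hEH : ∀ n, ∑ ij ∈ Finset.HasAntidiagonal.antidiagonal (n + 1),
      (-1 : R) ^ ij.1 * (E (ij.1 : ℕ) * H ij.2) = 0)
    (T m : ℕ) (hm : m ≤ T) (γ : ℕ → ℕ) (hγ : ∀ i, T - m ≤ i → γ i = 0) :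
    ∑ s ∈ Finset.powersetCard m (Finset.univ : Finset (Fin T)),
      (eMatrix E T (addIndicator γ s)).det = H m * (eMatrix E T γ).det := by
  rw [sum_det_eMatrix_addIndicator E T m hm, ← det_eMatrix_succ E hneg h0 T γ (hγ T (by omega))]
  set A := eMatrix E (T + 1) γ with hA
  -- The rows from `T - m` on have the entries `E (j - i)`, as `γ` vanishes there. They form a
  -- unitriangular Toeplitz block whose inverse has the signed `H` as entries; `c` is the first row
  -- of that inverse.
  set c : Fin (T + 1) → R := fun i =>
    if T - m ≤ (i : ℕ) then (-1) ^ ((i : ℕ) - (T - m)) * H ((i : ℕ) - (T - m)) else 0 with hc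
  have hrow : ∑ i, c i • A i = Pi.single (⟨T - m, by omega⟩ : Fin (T + 1)) 1 := by
    ext j
    set F : ℕ → R := fun i =>
      if T - m ≤ i then (-1) ^ (i - (T - m)) * H (i - (T - m)) * E ((j : ℕ) - (i : ℤ)) else 0
      with hF
    have h1 : (∑ i, c i • A i) j = ∑ i ∈ Finset.range (T + 1), F i := by
      rw [Finset.sum_apply, ← Fin.sum_univ_eq_sum_range]
      refine Finset.sum_congr rfl fun i _ => ?_
      simp only [Pi.smul_apply, smul_eq_mul, hc, hF, hA, eMatrix, Matrix.of_apply, ite_mul,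
        zero_mul]
      split_ifs with h
      · rw [hγ i h, Nat.cast_zero, zero_add]
      · rfl
    have hF0 : ∀ i : ℕ, (j : ℕ) < i → F i = 0 := by
      intro i hi
      simp only [hF]
      rw [hneg _ (by omega), mul_zero, ite_self]
    have hj := j.2
    rw [h1]
    rcases lt_or_ge (j : ℕ) (T - m) with h | h
    · rw [Finset.sum_eq_zero, Pi.single_eq_of_ne]
      · intro h'
        rw [h'] at h
        exact lt_irrefl _ h
      · intro i _
        rcases lt_or_ge (j : ℕ) i with h' | h'
        · exact hF0 i h'
        · simp only [hF]
          rw [if_neg (by omega)]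
    · obtain ⟨n, hn⟩ := Nat.exists_eq_add_of_le h
      rw [Finset.range_eq_Ico, ← Finset.sum_Ico_consecutive _ (Nat.zero_le (T - m)) (by omega),
        ← Finset.sum_Ico_consecutive _ (show T - m ≤ (j : ℕ) + 1 by omega) (by omega),
        Finset.sum_eq_zero (s := Finset.Ico 0 (T - m)),
        Finset.sum_eq_zero (s := Finset.Ico ((j : ℕ) + 1) (T + 1)), zero_add, add_zero,
        Finset.sum_Ico_eq_sum_range]
      · have h2 : ∀ b ∈ Finset.range (n + 1), F (T - m + b) =
            (-1) ^ n * ((-1) ^ (n - b) * (E ((n - b : ℕ) : ℤ) * H b)) := by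
          intro b hb
          rw [Finset.mem_range] at hb
          simp only [hF]
          have h3 : ((j : ℕ) : ℤ) - ((T - m + b : ℕ) : ℤ) = ((n - b : ℕ) : ℤ) := by omega
          have h4 : (-1 : R) ^ n * (-1) ^ (n - b) = (-1) ^ b := by
            have : n + (n - b) = 2 * (n - b) + b := by omega
            rw [← pow_add, this, pow_add, pow_mul, neg_one_sq, one_pow, one_mul]
          rw [if_pos (by omega), h3, Nat.add_sub_cancel_left, ← mul_assoc, h4]
          ring
        have h5 : (j : ℕ) + 1 - (T - m) = n + 1 := by omega
        rw [h5, Finset.sum_congr rfl h2, ← Finset.mul_sum,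
          ← Finset.sum_range_reflect]
        have h6 : ∑ a ∈ Finset.range (n + 1), (-1 : R) ^ (n - (n + 1 - 1 - a)) *
            (E ((n - (n + 1 - 1 - a) : ℕ) : ℤ) * H (n + 1 - 1 - a)) =
            ∑ a ∈ Finset.range n.succ, (-1 : R) ^ a * (E (a : ℕ) * H (n - a)) := by
          refine Finset.sum_congr rfl fun a ha => ?_
          rw [Finset.mem_range] at ha
          have h7 : n - (n + 1 - 1 - a) = a := by omega
          rw [h7]
          rfl
        rw [h6, ← Finset.Nat.sum_antidiagonal_eq_sum_range_succ
          (fun a b => (-1 : R) ^ a * (E (a : ℕ) * H b))]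
        rcases n with _ | n
        · have h8 : j = ⟨T - m, by omega⟩ := Fin.ext (by simpa using hn)
          rw [h8, Pi.single_eq_same]
          simp [h0, hH0]
        · rw [Pi.single_eq_of_ne, hEH n, mul_zero]
          intro h'
          rw [h'] at hn
          simp at hn
      · intro i hi
        rw [Finset.mem_Ico] at hi
        exact hF0 i (by omega)
      · intro i hi
        rw [Finset.mem_Ico] at hi
        simp only [hF]
        rw [if_neg (by omega)]
  have h1 := det_updateRow_sum A (Fin.last T) c
  rw [hrow, det_succ_row _ (Fin.last T), Finset.sum_eq_single (⟨T - m, by omega⟩ : Fin (T + 1))]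
    at h1
  · rw [updateRow_self, Pi.single_eq_same, submatrix_updateRow_succAbove, Fin.succAbove_last] at h1
    have h2 : c (Fin.last T) = (-1) ^ m * H m := by
      rw [hc]
      simp only [Fin.val_last]
      rw [if_pos (by omega), Nat.sub_sub_self hm]
    rw [h2] at h1
    -- The sign of the Laplace expansion equals the sign in `c`, so both cancel.
    have h3 : (-1 : R) ^ (T + (T - m)) = (-1) ^ m := by
      have : T + (T - m) = 2 * (T - m) + m := by omega
      rw [this, pow_add, pow_mul, neg_one_sq, one_pow, one_mul]
    simp only [Fin.val_last] at h1
    rw [h3, smul_eq_mul, mul_one, mul_assoc] at h1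
    exact (isUnit_one.neg.pow m).mul_left_cancel h1
  · intro j _ hj
    rw [updateRow_self, Pi.single_eq_of_ne hj]
    simp
  · simp

/-- Rows `i` and `i + 1` coincide. In the Pieri rule this removes the sequences that are not column
lengths of a diagram. -/
theorem det_eMatrix_eq_zero (E : ℤ → R) (T i : ℕ) (hi : i + 1 < T) (γ : ℕ → ℕ)
    (h : γ (i + 1) = γ i + 1) : (eMatrix E T γ).det = 0 := by
  refine det_zero_of_row_eq (i := ⟨i, by omega⟩) (j := ⟨i + 1, hi⟩) (by simp) ?_
  ext j
  simp only [eMatrix, Matrix.of_apply, h]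
  congr 1
  push_cast
  ring

end DualJacobiTrudi


/-! ### Young diagrams -/

namespace YoungDiagram

theorem colLen_le_card (μ : YoungDiagram) (j : ℕ) : μ.colLen j ≤ μ.card := by
  rw [colLen_eq_card]
  exact Finset.card_le_card (Finset.filter_subset _ _)

theorem rowLen_le_card (μ : YoungDiagram) (i : ℕ) : μ.rowLen i ≤ μ.card := by
  rw [rowLen_eq_card]
  exact Finset.card_le_card (Finset.filter_subset _ _)

theorem colLen_eq_zero_of_rowLen_le (μ : YoungDiagram) {j : ℕ} (h : μ.rowLen 0 ≤ j) :
    μ.colLen j = 0 := by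
  by_contra hne
  have h1 : (0, j) ∈ μ := mem_iff_lt_colLen.2 (Nat.pos_of_ne_zero hne)
  exact absurd (mem_iff_lt_rowLen.1 h1) (not_lt.2 h)

theorem colLen_eq_zero_of_card_le (μ : YoungDiagram) {j : ℕ} (h : μ.card ≤ j) : μ.colLen j = 0 :=
  μ.colLen_eq_zero_of_rowLen_le ((μ.rowLen_le_card 0).trans h)

theorem ext_colLen {μ ν : YoungDiagram} (h : ∀ j, μ.colLen j = ν.colLen j) : μ = ν := by
  refine SetLike.ext fun c => ?_
  obtain ⟨i, j⟩ := c
  rw [mem_iff_lt_colLen, mem_iff_lt_colLen, h]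

theorem ext_rowLen {μ ν : YoungDiagram} (h : ∀ i, μ.rowLen i = ν.rowLen i) : μ = ν := by
  refine SetLike.ext fun c => ?_
  obtain ⟨i, j⟩ := c
  rw [mem_iff_lt_rowLen, mem_iff_lt_rowLen, h]

theorem card_eq_sum_colLen (μ : YoungDiagram) {T : ℕ} (h : μ.rowLen 0 ≤ T) :
    μ.card = ∑ j ∈ Finset.range T, μ.colLen j := by
  have h1 : ∀ c ∈ μ.cells, c.2 ∈ Finset.range T := by
    rintro ⟨i, j⟩ hc
    rw [Finset.mem_range]
    have h2 : (0, j) ∈ μ := μ.up_left_mem (Nat.zero_le i) le_rfl hc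
    exact (mem_iff_lt_rowLen.1 h2).trans_le h
  rw [YoungDiagram.card, Finset.card_eq_sum_card_fiberwise h1]
  refine Finset.sum_congr rfl fun j _ => ?_
  rw [colLen_eq_card]
  rfl

theorem finite_setOf_card_eq (n : ℕ) : {μ : YoungDiagram | μ.card = n}.Finite := by
  refine Set.Finite.of_finite_image (f := YoungDiagram.cells)
    ((Finset.finite_toSet (Finset.range n ×ˢ Finset.range n).powerset).subset ?_) ?_
  · rintro _ ⟨μ, hμ, rfl⟩
    rw [Finset.mem_coe, Finset.mem_powerset]
    rintro ⟨i, j⟩ hc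
    have hμ : μ.card = n := hμ
    rw [mem_cells] at hc
    rw [Finset.mem_product, Finset.mem_range, Finset.mem_range, ← hμ]
    exact ⟨(mem_iff_lt_colLen.1 hc).trans_le (μ.colLen_le_card j),
      (mem_iff_lt_rowLen.1 hc).trans_le (μ.rowLen_le_card i)⟩
  · intro μ _ ν _ h
    exact YoungDiagram.ext h

/-- The Young diagrams with `n` cells. -/
def ofCard (n : ℕ) : Finset YoungDiagram := (finite_setOf_card_eq n).toFinset

@[simp] theorem mem_ofCard {n : ℕ} {μ : YoungDiagram} : μ ∈ ofCard n ↔ μ.card = n := by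
  simp [ofCard]

/-- The Young diagram with given column lengths. -/
def ofColLens (δ : ℕ → ℕ) (hδ : Antitone δ) (T : ℕ) : YoungDiagram where
  cells := (Finset.range (δ 0) ×ˢ Finset.range T).filter fun c => c.1 < δ c.2
  isLowerSet := by
    rintro ⟨i, j⟩ ⟨i', j'⟩ hle hc
    obtain ⟨h1, h2⟩ := Prod.mk_le_mk.1 hle
    simp only [Finset.coe_filter, Finset.mem_product, Finset.mem_range, Set.mem_ofPred_eq] at hc ⊢
    have h3 := hδ h2
    omega

theorem colLen_ofColLens (δ : ℕ → ℕ) (hδ : Antitone δ) (T : ℕ) (hT : ∀ j, T ≤ j → δ j = 0)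
    (j : ℕ) : (ofColLens δ hδ T).colLen j = δ j := by
  have h : ∀ i, i < (ofColLens δ hδ T).colLen j ↔ i < δ j := by
    intro i
    rw [← mem_iff_lt_colLen, ← mem_cells]
    simp only [ofColLens, Finset.mem_filter, Finset.mem_product, Finset.mem_range]
    have h1 := hδ (Nat.zero_le j)
    have h2 := hT j
    by_cases h3 : T ≤ j
    · have := h2 h3
      omega
    · omega
  exact le_antisymm (not_lt.1 fun h' => lt_irrefl _ ((h _).1 h'))
    (not_lt.1 fun h' => lt_irrefl _ ((h _).2 h'))

/-- The skew diagram `ν / μ` is a horizontal strip. -/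
def HorizontalStrip (μ ν : YoungDiagram) : Prop :=
  ∀ j, μ.colLen j ≤ ν.colLen j ∧ ν.colLen j ≤ μ.colLen j + 1

theorem HorizontalStrip.le {μ ν : YoungDiagram} (h : HorizontalStrip μ ν) : μ ≤ ν := by
  rintro ⟨i, j⟩ hc
  exact mem_iff_lt_colLen.2 ((mem_iff_lt_colLen.1 hc).trans_le (h j).1)

end YoungDiagram

open YoungDiagram

open scoped Classical in
/-- The Pieri rule for dual Jacobi–Trudi determinants. -/
theorem sum_det_eMatrix_eq_sum_horizontalStrip {R : Type*} [CommRing R] (E : ℤ → R)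
    (μ : YoungDiagram) (k T : ℕ) (hT : μ.card + k ≤ T) :
    ∑ s ∈ Finset.powersetCard k (Finset.univ : Finset (Fin T)),
      (eMatrix E T (addIndicator μ.colLen s)).det =
    ∑ ν ∈ (ofCard (μ.card + k)).filter (HorizontalStrip μ), (eMatrix E T ν.colLen).det := by
  symm
  -- A horizontal strip is encoded by the set of columns to which it adds a cell.
  set e : YoungDiagram → Finset (Fin T) := fun ν =>
    Finset.univ.filter fun i : Fin T => ν.colLen i = μ.colLen i + 1 with he
  have hval : ∀ ν, HorizontalStrip μ ν → ∀ i < T, ν.colLen i = addIndicator μ.colLen (e ν) i := by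
    intro ν hν i hi
    have h1 := addIndicator_val μ.colLen (e ν) ⟨i, hi⟩
    simp only at h1
    rw [h1, he]
    simp only [Finset.mem_filter, Finset.mem_univ, true_and]
    have := hν i
    split_ifs <;> omega
  have hsum : ∀ s : Finset (Fin T), ∑ i ∈ Finset.range T, addIndicator μ.colLen s i =
      μ.card + s.card := by
    intro s
    rw [← Fin.sum_univ_eq_sum_range, μ.card_eq_sum_colLen
      (((μ.rowLen_le_card 0).trans (Nat.le_add_right _ k)).trans hT), ← Fin.sum_univ_eq_sum_range]
    simp [addIndicator_val, Finset.sum_add_distrib]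
  refine Finset.sum_of_injOn e ?_ ?_ ?_ ?_
  · intro ν hν ν' hν' h
    simp only [Finset.coe_filter, mem_ofCard, Set.mem_ofPred_eq] at hν hν'
    refine ext_colLen fun j => ?_
    rcases lt_or_ge j T with hj | hj
    · rw [hval ν hν.2 j hj, hval ν' hν'.2 j hj, h]
    · rw [ν.colLen_eq_zero_of_card_le (by omega), ν'.colLen_eq_zero_of_card_le (by omega)]
  · intro ν hν
    simp only [Finset.coe_filter, mem_ofCard, Set.mem_ofPred_eq] at hν
    rw [Finset.mem_coe, Finset.mem_powersetCard]
    refine ⟨Finset.subset_univ _, ?_⟩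
    have h1 := hsum (e ν)
    rw [← Finset.sum_congr rfl fun i hi => hval ν hν.2 i (Finset.mem_range.1 hi),
      ← ν.card_eq_sum_colLen (by have := ν.rowLen_le_card 0; omega)] at h1
    omega
  · intro s hs hne
    rw [Finset.mem_powersetCard] at hs
    by_contra hdet
    have hzero : ∀ j, T ≤ j → addIndicator μ.colLen s j = 0 := by
      intro j hj
      have h1 : j ∉ s.map Fin.valEmbedding := by
        rw [Finset.mem_map]
        rintro ⟨i, -, rfl⟩
        exact absurd i.2 (not_lt.2 hj)
      rw [addIndicator, if_neg h1, μ.colLen_eq_zero_of_card_le (by omega)]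
    -- Adding at most 1 to each term of an antitone sequence can only break monotonicity by making a
    -- term exceed its predecessor by exactly 1, and then the determinant vanishes. So a set `s`
    -- with nonzero determinant comes from a diagram.
    have hanti : Antitone (addIndicator μ.colLen s) := by
      refine antitone_nat_of_succ_le fun i => ?_
      rcases lt_or_ge (i + 1) T with hi | hi
      · by_contra hlt
        refine hdet (det_eMatrix_eq_zero E T i hi _ ?_)
        have h1 := μ.colLen_anti i (i + 1) (Nat.le_succ i)
        simp only [addIndicator] at hlt ⊢
        split_ifs at hlt ⊢ <;> omega
      · rw [hzero _ hi]
        exact Nat.zero_le _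
    have hcol := colLen_ofColLens _ hanti T hzero
    refine hne ⟨ofColLens _ hanti T, ?_, ?_⟩
    · simp only [Finset.coe_filter, mem_ofCard, Set.mem_ofPred_eq]
      constructor
      · have h1 : (ofColLens _ hanti T).rowLen 0 ≤ T := by
          by_contra hlt
          have h2 := mem_iff_lt_colLen.1 (mem_iff_lt_rowLen.2 (not_le.1 hlt))
          rw [hcol, hzero T le_rfl] at h2
          exact absurd h2 (lt_irrefl 0)
        rw [card_eq_sum_colLen _ h1]
        simp only [hcol]
        rw [hsum, hs.2]
      · intro j
        rw [hcol, addIndicator]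
        split_ifs <;> omega
    · ext i
      rw [he]
      simp only [Finset.mem_filter, Finset.mem_univ, true_and, hcol, addIndicator_val]
      split_ifs with h <;> simp [h]
  · intro ν hν
    simp only [Finset.mem_filter, mem_ofCard] at hν
    rw [eMatrix_congr E T (hval ν hν.2)]

/-! ### Kostka numbers -/

/-- The content of a semistandard Young tableau. -/
def tableauContent {μ : YoungDiagram} (T : SemistandardYoungTableau μ) : ℕ →₀ ℕ :=
  ∑ c ∈ μ.cells, Finsupp.single (T c.1 c.2) 1

/-- The number of semistandard Young tableaux of given shape and content. -/
def kostka (μ : YoungDiagram) (m : ℕ →₀ ℕ) : ℕ :=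
  Set.ncard {T : SemistandardYoungTableau μ | tableauContent T = m}

theorem tableauContent_apply {μ : YoungDiagram} (T : SemistandardYoungTableau μ) (i : ℕ) :
    tableauContent T i = (μ.cells.filter fun c => T c.1 c.2 = i).card := by
  rw [tableauContent, Finsupp.finsetSum_apply, Finset.card_filter]
  simp [Finsupp.single_apply]

theorem degree_tableauContent {μ : YoungDiagram} (T : SemistandardYoungTableau μ) :
    (tableauContent T).degree = μ.card := by
  simp [tableauContent, map_sum, YoungDiagram.card]

theorem tableauContent_entry_ne_zero {μ : YoungDiagram} (T : SemistandardYoungTableau μ) {i j : ℕ}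
    (h : (i, j) ∈ μ) : tableauContent T (T i j) ≠ 0 := by
  rw [tableauContent_apply]
  exact Finset.card_ne_zero_of_mem (Finset.mem_filter.2 ⟨h, rfl⟩)

theorem entry_lt_of_content {μ : YoungDiagram} (T : SemistandardYoungTableau μ) {m : ℕ →₀ ℕ}
    (hT : tableauContent T = m) {p : ℕ} (hm : ∀ i, p ≤ i → m i = 0) {i j : ℕ} (h : (i, j) ∈ μ) :
    T i j < p := by
  by_contra hlt
  exact tableauContent_entry_ne_zero T h (by rw [hT, hm _ (not_lt.1 hlt)])

theorem exists_bound (m : ℕ →₀ ℕ) : ∃ p, ∀ i, p ≤ i → m i = 0 := by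
  obtain ⟨p, hp⟩ := m.support.exists_nat_subset_range
  refine ⟨p, fun i hi => ?_⟩
  by_contra hne
  exact absurd (Finset.mem_range.1 (hp (Finsupp.mem_support_iff.2 hne))) (not_lt.2 hi)

theorem finite_tableaux_of_content (μ : YoungDiagram) (m : ℕ →₀ ℕ) :
    {T : SemistandardYoungTableau μ | tableauContent T = m}.Finite := by
  obtain ⟨p, hp⟩ := exists_bound m
  let g : SemistandardYoungTableau μ → (μ.cells → ℕ) := fun T c => T c.1.1 c.1.2
  refine Set.Finite.of_finite_image (f := g)
    ((Set.Finite.pi' (t := fun _ => Set.Iio p) fun _ => Set.finite_Iio p).subset ?_) ?_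
  · rintro _ ⟨T, hT, rfl⟩ c
    exact entry_lt_of_content T hT hp c.2
  · intro T _ T' _ h
    refine SemistandardYoungTableau.ext fun i j => ?_
    by_cases hc : (i, j) ∈ μ
    · exact congrFun h ⟨(i, j), hc⟩
    · rw [T.zeros hc, T'.zeros hc]

theorem kostka_eq_zero_of_degree_ne {μ : YoungDiagram} {m : ℕ →₀ ℕ} (h : m.degree ≠ μ.card) :
    kostka μ m = 0 := by
  rw [kostka, Set.ncard_eq_zero (finite_tableaux_of_content μ m), Set.eq_empty_iff_forall_notMem]
  intro T hT
  have hT : tableauContent T = m := hT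
  exact h (by rw [← hT, degree_tableauContent])

/-- The cells of a tableau with entries less than `p`. -/
def subshape {ν : YoungDiagram} (T : SemistandardYoungTableau ν) (p : ℕ) : YoungDiagram where
  cells := ν.cells.filter fun c => T c.1 c.2 < p
  isLowerSet := by
    rintro ⟨i, j⟩ ⟨i', j'⟩ hle hc
    obtain ⟨h1, h2⟩ := Prod.mk_le_mk.1 hle
    simp only [Finset.coe_filter, Set.mem_ofPred_eq, mem_cells] at hc ⊢
    have h3 : (i', j) ∈ ν := ν.up_left_mem h1 le_rfl hc.1
    exact ⟨ν.up_left_mem h1 h2 hc.1,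
      ((T.row_weak_of_le h2 h3).trans (T.col_weak h1 hc.1)).trans_lt hc.2⟩

theorem mem_subshape {ν : YoungDiagram} (T : SemistandardYoungTableau ν) (p i j : ℕ) :
    (i, j) ∈ subshape T p ↔ (i, j) ∈ ν ∧ T i j < p := by
  rw [← mem_cells]
  simp [subshape]

/-- Columns increase strictly, so the largest entry `p` occurs at most once in each. -/
theorem horizontalStrip_subshape {ν : YoungDiagram} (T : SemistandardYoungTableau ν) (p : ℕ)
    (hT : ∀ i j, (i, j) ∈ ν → T i j ≤ p) : HorizontalStrip (subshape T p) ν := by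
  intro j
  constructor
  · by_contra hlt
    have h1 := (mem_subshape T p _ _).1 (mem_iff_lt_colLen.2 (not_le.1 hlt))
    exact absurd (mem_iff_lt_colLen.1 h1.1) (lt_irrefl _)
  · by_contra hlt
    have h1 : ((subshape T p).colLen j + 1, j) ∈ ν := mem_iff_lt_colLen.2 (not_le.1 hlt)
    have h2 := T.col_strict (Nat.lt_add_one ((subshape T p).colLen j)) h1
    have h3 := hT _ _ h1
    have h4 : ((subshape T p).colLen j, j) ∈ subshape T p :=
      (mem_subshape T p _ _).2 ⟨ν.up_left_mem (Nat.le_succ _) le_rfl h1, by omega⟩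
    exact absurd (mem_iff_lt_colLen.1 h4) (lt_irrefl _)

/-- The restriction of a tableau to its entries less than `p`. -/
def restrictTableau {ν : YoungDiagram} (T : SemistandardYoungTableau ν) (p : ℕ) :
    SemistandardYoungTableau (subshape T p) where
  entry i j := if (i, j) ∈ subshape T p then T i j else 0
  row_weak' hj hc := by
    rw [if_pos hc, if_pos ((subshape T p).up_left_mem le_rfl hj.le hc)]
    exact T.row_weak hj ((mem_subshape T p _ _).1 hc).1
  col_strict' hi hc := by
    rw [if_pos hc, if_pos ((subshape T p).up_left_mem hi.le le_rfl hc)]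
    exact T.col_strict hi ((mem_subshape T p _ _).1 hc).1
  zeros' hc := if_neg hc

open scoped Classical in
/-- The extension of a tableau by entries `p` in a horizontal strip. -/
def extendTableau {μ ν : YoungDiagram} (h : HorizontalStrip μ ν) (p : ℕ)
    (T : SemistandardYoungTableau μ) (hT : ∀ i j, (i, j) ∈ μ → T i j < p) :
    SemistandardYoungTableau ν where
  entry i j := if (i, j) ∈ μ then T i j else if (i, j) ∈ ν then p else 0
  row_weak' {i j1 j2} hj hc := by
    by_cases h2 : (i, j2) ∈ μ
    · rw [if_pos h2, if_pos (μ.up_left_mem le_rfl hj.le h2)]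
      exact T.row_weak hj h2
    · rw [if_neg h2, if_pos hc]
      split_ifs with h1
      · exact (hT _ _ h1).le
      · exact le_rfl
      · exact Nat.zero_le _
  col_strict' {i1 i2 j} hi hc := by
    by_cases h2 : (i2, j) ∈ μ
    · rw [if_pos h2, if_pos (μ.up_left_mem hi.le le_rfl h2)]
      exact T.col_strict hi h2
    · have h1 : (i1, j) ∈ μ := by
        rw [mem_iff_lt_colLen] at hc ⊢
        have := h j
        omega
      rw [if_neg h2, if_pos hc, if_pos h1]
      exact hT _ _ h1
  zeros' hc := by
    rw [if_neg fun h' => hc (h.le h'), if_neg hc]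

theorem extendTableau_of_mem {μ ν : YoungDiagram} (h : HorizontalStrip μ ν) (p : ℕ)
    (T : SemistandardYoungTableau μ) (hT : ∀ i j, (i, j) ∈ μ → T i j < p) {i j : ℕ}
    (hc : (i, j) ∈ μ) : extendTableau h p T hT i j = T i j := if_pos hc

theorem extendTableau_of_notMem {μ ν : YoungDiagram} (h : HorizontalStrip μ ν) (p : ℕ)
    (T : SemistandardYoungTableau μ) (hT : ∀ i j, (i, j) ∈ μ → T i j < p) {i j : ℕ}
    (hc : (i, j) ∉ μ) (hc' : (i, j) ∈ ν) : extendTableau h p T hT i j = p :=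
  (if_neg hc).trans (if_pos hc')

theorem subshape_extendTableau {μ ν : YoungDiagram} (h : HorizontalStrip μ ν) (p : ℕ)
    (T : SemistandardYoungTableau μ) (hT : ∀ i j, (i, j) ∈ μ → T i j < p) :
    subshape (extendTableau h p T hT) p = μ := by
  refine SetLike.ext fun c => ?_
  obtain ⟨i, j⟩ := c
  rw [mem_subshape]
  constructor
  · rintro ⟨h1, h2⟩
    by_contra h3
    rw [extendTableau_of_notMem h p T hT h3 h1] at h2
    exact lt_irrefl _ h2
  · intro h1
    rw [extendTableau_of_mem h p T hT h1]
    exact ⟨h.le h1, hT _ _ h1⟩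

theorem tableauContent_apply_eq_of_subshape {μ ν : YoungDiagram} (T : SemistandardYoungTableau ν)
    (T' : SemistandardYoungTableau μ) (p : ℕ) (hμ : subshape T p = μ)
    (h : ∀ i j, (i, j) ∈ μ → T i j = T' i j) (i : ℕ) (hi : i < p) :
    tableauContent T i = tableauContent T' i := by
  subst hμ
  rw [tableauContent_apply, tableauContent_apply]
  congr 1
  ext ⟨a, b⟩
  simp only [Finset.mem_filter, mem_cells, mem_subshape] at h ⊢
  constructor
  · rintro ⟨h1, h2⟩
    have h3 : T a b < p := by omega
    exact ⟨⟨h1, h3⟩, by rw [← h a b ⟨h1, h3⟩, h2]⟩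
  · rintro ⟨h1, h2⟩
    exact ⟨h1.1, by rw [h a b h1, h2]⟩

open scoped Classical in
-- The cells with the largest entry `p` form a horizontal strip, and deleting them leaves a tableau
-- of content `m`. The tableaux of shape `ν` are sorted by the shape `μ` that remains;
-- `extendTableau` and `restrictTableau` are inverse bijections on each class.
theorem kostka_add_single (ν : YoungDiagram) (m : ℕ →₀ ℕ) (p k : ℕ) (hm : ∀ i, p ≤ i → m i = 0)
    (hν : ν.card = m.degree + k) :
    kostka ν (m + Finsupp.single p k) =
      ∑ μ ∈ (ofCard m.degree).filter (fun μ => HorizontalStrip μ ν), kostka μ m := by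
  have hfin := finite_tableaux_of_content ν (m + Finsupp.single p k)
  have hle : ∀ T : SemistandardYoungTableau ν, tableauContent T = m + Finsupp.single p k →
      ∀ i j, (i, j) ∈ ν → T i j ≤ p := by
    intro T hT i j hc
    refine Nat.lt_succ_iff.1 (entry_lt_of_content T hT (p := p + 1) (fun i hi => ?_) hc)
    rw [Finsupp.add_apply, hm i (by omega), Finsupp.single_eq_of_ne (by omega), add_zero]
  have hres : ∀ T : SemistandardYoungTableau ν, tableauContent T = m + Finsupp.single p k →
      tableauContent (restrictTableau T p) = m := by
    intro T hT
    ext i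
    rcases lt_or_ge i p with hi | hi
    · rw [← tableauContent_apply_eq_of_subshape T (restrictTableau T p) p rfl
        (fun a b hc => (if_pos hc).symm) i hi, hT, Finsupp.add_apply,
        Finsupp.single_eq_of_ne (by omega), add_zero]
    · rw [hm i hi, tableauContent_apply, Finset.card_eq_zero, Finset.filter_eq_empty_iff]
      rintro ⟨a, b⟩ hc h1
      have h2 : restrictTableau T p a b = T a b := if_pos hc
      rw [mem_cells, mem_subshape] at hc
      simp only [h2] at h1
      omega
  rw [kostka, Set.ncard_eq_toFinset_card _ hfin, Finset.card_eq_sum_card_fiberwise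
    (f := fun T => subshape T p) (t := (ofCard m.degree).filter (fun μ => HorizontalStrip μ ν))]
  · refine Finset.sum_congr rfl fun μ hμ => ?_
    rw [Finset.mem_filter, mem_ofCard] at hμ
    rw [kostka, ← Set.ncard_coe_finset]
    symm
    refine Set.ncard_congr
      (fun T hT => extendTableau hμ.2 p T fun i j => entry_lt_of_content T hT hm) ?_ ?_ ?_
    · intro T hT
      have hlt : ∀ i j, (i, j) ∈ μ → T i j < p := fun i j => entry_lt_of_content T hT hm
      have hsub := subshape_extendTableau hμ.2 p T hlt
      simp only [Finset.coe_filter, Set.Finite.mem_toFinset, Set.mem_ofPred_eq]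
      refine ⟨?_, hsub⟩
      have h1 : ∀ i < p, tableauContent (extendTableau hμ.2 p T hlt) i = m i := by
        intro i hi
        rw [tableauContent_apply_eq_of_subshape _ T p hsub
          (fun a b hc => extendTableau_of_mem hμ.2 p T hlt hc) i hi, hT]
      ext i
      rw [Finsupp.add_apply]
      rcases lt_trichotomy i p with hi | rfl | hi
      · rw [h1 i hi, Finsupp.single_eq_of_ne (by omega), add_zero]
      · rw [hm i le_rfl, Finsupp.single_eq_same, zero_add, tableauContent_apply]
        have h2 : (ν.cells.filter fun c => extendTableau hμ.2 i T hlt c.1 c.2 = i) =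
            ν.cells \ μ.cells := by
          ext ⟨a, b⟩
          simp only [Finset.mem_filter, Finset.mem_sdiff, mem_cells]
          refine and_congr_right fun hc => ⟨fun h2 h3 => ?_, fun h2 => ?_⟩
          · rw [extendTableau_of_mem hμ.2 i T hlt h3] at h2
            exact absurd (hlt a b h3) (by omega)
          · exact extendTableau_of_notMem hμ.2 i T hlt h2 hc
        rw [h2, Finset.card_sdiff_of_subset (cells_subset_iff.2 hμ.2.le)]
        have h3 : ν.cells.card = m.degree + k := hν
        have h4 : μ.cells.card = m.degree := hμ.1
        omega
      · rw [hm i hi.le, Finsupp.single_eq_of_ne (by omega), add_zero, tableauContent_apply,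
          Finset.card_eq_zero, Finset.filter_eq_empty_iff]
        rintro ⟨a, b⟩ hc h2
        simp only at h2
        by_cases h3 : (a, b) ∈ μ
        · rw [extendTableau_of_mem hμ.2 p T hlt h3] at h2
          exact absurd (hlt a b h3) (by omega)
        · rw [extendTableau_of_notMem hμ.2 p T hlt h3 hc] at h2
          omega
    · intro T T' hT hT' h
      have hlt : ∀ i j, (i, j) ∈ μ → T i j < p := fun i j => entry_lt_of_content T hT hm
      have hlt' : ∀ i j, (i, j) ∈ μ → T' i j < p := fun i j => entry_lt_of_content T' hT' hm
      refine SemistandardYoungTableau.ext fun i j => ?_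
      by_cases hc : (i, j) ∈ μ
      · rw [← extendTableau_of_mem hμ.2 p T hlt hc, ← extendTableau_of_mem hμ.2 p T' hlt' hc]
        exact congrFun (congrFun (congrArg DFunLike.coe h) i) j
      · rw [T.zeros hc, T'.zeros hc]
    · intro T hT
      simp only [Finset.coe_filter, Set.Finite.mem_toFinset, Set.mem_ofPred_eq] at hT
      obtain ⟨hT, rfl⟩ := hT
      refine ⟨restrictTableau T p, hres T hT, ?_⟩
      refine SemistandardYoungTableau.ext fun i j => ?_
      by_cases hc : (i, j) ∈ ν
      · by_cases hc' : (i, j) ∈ subshape T p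
        · rw [extendTableau_of_mem _ _ _ _ hc']
          exact if_pos hc'
        · rw [extendTableau_of_notMem _ _ _ _ hc' hc]
          rw [mem_subshape] at hc'
          have h1 := hle T hT i j hc
          have h2 : ¬ T i j < p := fun h2 => hc' ⟨hc, h2⟩
          omega
      · rw [T.zeros hc, SemistandardYoungTableau.zeros _ hc]
  · intro T hT
    rw [Finset.mem_coe, Set.Finite.mem_toFinset] at hT
    rw [Finset.mem_coe, Finset.mem_filter, mem_ofCard]
    exact ⟨by rw [← degree_tableauContent (restrictTableau T p), hres T hT],
      horizontalStrip_subshape T p (hle T hT)⟩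

theorem kostka_bot_zero : kostka ⊥ 0 = 1 := by
  rw [kostka, Set.ncard_eq_one]
  refine ⟨default, Set.eq_singleton_iff_unique_mem.2 ⟨?_, fun T _ => ?_⟩⟩
  · simp [tableauContent]
  · refine SemistandardYoungTableau.ext fun i j => ?_
    rw [T.zeros (notMem_bot _), SemistandardYoungTableau.zeros _ (notMem_bot _)]

/-- The products of complete homogeneous symmetric functions in terms of dual Jacobi–Trudi
determinants, for sequences `E` and `H` that are related as the elementary and the complete
homogeneous symmetric functions. -/
theorem prod_H_eq_sum_kostka {R : Type*} [CommRing R] (E : ℤ → R) (hneg : ∀ d < 0, E d = 0)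
    (h0 : E 0 = 1) (H : ℕ → R) (hH0 : H 0 = 1)
    (hEH : ∀ n, ∑ ij ∈ Finset.HasAntidiagonal.antidiagonal (n + 1),
      (-1 : R) ^ ij.1 * (E (ij.1 : ℕ) * H ij.2) = 0) (T p : ℕ) :
    ∀ m : ℕ →₀ ℕ, (∀ i, p ≤ i → m i = 0) → m.degree ≤ T →
    ∏ i ∈ Finset.range p, H (m i) =
      ∑ μ ∈ ofCard m.degree, (kostka μ m : R) * (eMatrix E T μ.colLen).det := by
  classical
  induction p with
  | zero =>
    intro m hm _
    have h1 : m = 0 := Finsupp.ext fun i => hm i (Nat.zero_le i)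
    subst h1
    have h2 : ofCard (0 : ℕ →₀ ℕ).degree = {⊥} := by
      ext μ
      rw [mem_ofCard, Finset.mem_singleton, map_zero, YoungDiagram.card, Finset.card_eq_zero]
      exact ⟨fun h => YoungDiagram.ext (by rw [h, cells_bot]), fun h => by rw [h, cells_bot]⟩
    rw [h2, Finset.sum_singleton, kostka_bot_zero,
      det_eMatrix_of_le E hneg h0 (Nat.zero_le T) _ fun i _ =>
        (⊥ : YoungDiagram).colLen_eq_zero_of_card_le (Nat.zero_le i)]
    simp
  | succ p ih =>
    intro m hm hT
    obtain ⟨m', k, hm', rfl⟩ : ∃ m' : ℕ →₀ ℕ, ∃ k, (∀ i, p ≤ i → m' i = 0) ∧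
        m = m' + Finsupp.single p k := by
      refine ⟨m.erase p, m p, fun i hi => ?_, (Finsupp.erase_add_single p m).symm⟩
      rcases eq_or_ne i p with rfl | hne
      · exact Finsupp.erase_same
      · rw [Finsupp.erase_ne hne, hm i (by omega)]
    have hdeg : (m' + Finsupp.single p k).degree = m'.degree + k := by simp
    rw [hdeg] at hT ⊢
    have h1 : ∏ i ∈ Finset.range p, H ((m' + Finsupp.single p k) i) =
        ∏ i ∈ Finset.range p, H (m' i) := by
      refine Finset.prod_congr rfl fun i hi => ?_
      rw [Finset.mem_range] at hi
      rw [Finsupp.add_apply, Finsupp.single_eq_of_ne (by omega), add_zero]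
    rw [Finset.prod_range_succ, h1, ih m' hm' (by omega), Finsupp.add_apply, hm' p le_rfl,
      Finsupp.single_eq_same, zero_add, Finset.sum_mul]
    -- The Pieri rule for the last factor. As `T` is at least `μ.card + k`, column lengths vanish
    -- from index `T - k` on, as that rule requires.
    have h2 : ∀ μ ∈ ofCard m'.degree, (kostka μ m' : R) * (eMatrix E T μ.colLen).det * H k =
        ∑ ν ∈ (ofCard (m'.degree + k)).filter (HorizontalStrip μ),
          (kostka μ m' : R) * (eMatrix E T ν.colLen).det := by
      intro μ hμ
      rw [mem_ofCard] at hμ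
      have h3 := sum_det_eMatrix_addIndicator_eq_mul E hneg h0 H hH0 hEH T k (by omega) μ.colLen
        fun i hi => μ.colLen_eq_zero_of_card_le (by omega)
      rw [sum_det_eMatrix_eq_sum_horizontalStrip E μ k T (by omega), hμ] at h3
      rw [mul_assoc, mul_comm _ (H k), ← h3, Finset.mul_sum]
    -- After the order of summation is exchanged, the inner sum over `μ` is the recursion for the
    -- Kostka numbers.
    rw [Finset.sum_congr rfl h2, Finset.sum_comm' (t' := ofCard (m'.degree + k))
      (s' := fun ν => (ofCard m'.degree).filter fun μ => HorizontalStrip μ ν)]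
    · refine Finset.sum_congr rfl fun ν hν => ?_
      rw [mem_ofCard] at hν
      rw [kostka_add_single ν m' p k hm' hν, Nat.cast_sum, Finset.sum_mul]
    · intro μ ν
      simp only [Finset.mem_filter]
      tauto


/-! ### Linear independence of the Schur functions -/

open YoungDiagram

/-- The sum of the row indices of the cells of a Young diagram. -/
def rowIndexSum (μ : YoungDiagram) : ℕ := ∑ c ∈ μ.cells, c.1

theorem rowIndex_le_entry {μ : YoungDiagram} (T : SemistandardYoungTableau μ) {i j : ℕ}
    (h : (i, j) ∈ μ) : i ≤ T i j := by
  induction i with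
  | zero => exact Nat.zero_le _
  | succ i ih =>
    exact (ih (μ.up_left_mem (Nat.le_succ i) le_rfl h)).trans_lt (T.col_strict (Nat.lt_succ_self i) h)

theorem weight_tableauContent {μ : YoungDiagram} (T : SemistandardYoungTableau μ) :
    Finsupp.weight (fun i : ℕ => i) (tableauContent T) = ∑ c ∈ μ.cells, T c.1 c.2 := by
  simp [tableauContent, map_sum, Finsupp.weight_single]

theorem tableauContent_eq_rowLen {μ : YoungDiagram} (T : SemistandardYoungTableau μ)
    (hT : ∀ i j, (i, j) ∈ μ → T i j = i) (i : ℕ) : tableauContent T i = μ.rowLen i := by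
  rw [tableauContent_apply, rowLen_eq_card]
  congr 1
  ext ⟨a, b⟩
  simp only [Finset.mem_filter, mem_cells, mem_row_iff]
  refine and_congr_right fun hc => ?_
  rw [hT a b hc]

theorem tableauContent_highestWeight (μ : YoungDiagram) (i : ℕ) :
    tableauContent (SemistandardYoungTableau.highestWeight μ) i = μ.rowLen i :=
  tableauContent_eq_rowLen _ (fun _ _ hc => if_pos hc) i

theorem weight_highestWeight (μ : YoungDiagram) : Finsupp.weight (fun i : ℕ => i)
    (tableauContent (SemistandardYoungTableau.highestWeight μ)) = rowIndexSum μ := by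
  rw [weight_tableauContent]
  exact Finset.sum_congr rfl fun c hc => if_pos hc

/-- The sum of the entries of `T` depends only on its content, hence equals `rowIndexSum lam`, while
each entry is at least its row index. Equality forces every entry to be its row index, and then the
content lists the row lengths. Here `rowIndexSum` does the work of the dominance order. -/
theorem rowIndexSum_le_and_eq {μ lam : YoungDiagram} (T : SemistandardYoungTableau μ)
    (hT : tableauContent T = tableauContent (SemistandardYoungTableau.highestWeight lam)) :
    rowIndexSum μ ≤ rowIndexSum lam ∧
      (rowIndexSum lam ≤ rowIndexSum μ → μ = lam ∧ ∀ i j, (i, j) ∈ μ → T i j = i) := by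
  have h1 : ∑ c ∈ μ.cells, T c.1 c.2 = rowIndexSum lam := by
    rw [← weight_tableauContent, hT, weight_highestWeight]
  have h2 : ∀ c ∈ μ.cells, c.1 ≤ T c.1 c.2 := fun c hc => rowIndex_le_entry T hc
  have h3 := Finset.sum_le_sum h2
  rw [h1] at h3
  refine ⟨h3, fun h4 => ?_⟩
  have h5 := (Finset.sum_eq_sum_iff_of_le h2).1 (by rw [h1]; exact le_antisymm h3 h4)
  have h6 : ∀ i j, (i, j) ∈ μ → T i j = i := fun i j hc => (h5 (i, j) hc).symm
  refine ⟨ext_rowLen fun i => ?_, h6⟩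
  rw [← tableauContent_eq_rowLen T h6, hT, tableauContent_highestWeight]

theorem kostka_self (lam : YoungDiagram) :
    kostka lam (tableauContent (SemistandardYoungTableau.highestWeight lam)) = 1 := by
  rw [kostka, Set.ncard_eq_one]
  refine ⟨SemistandardYoungTableau.highestWeight lam,
    Set.eq_singleton_iff_unique_mem.2 ⟨rfl, fun T hT => ?_⟩⟩
  have h := ((rowIndexSum_le_and_eq T hT).2 le_rfl).2
  refine SemistandardYoungTableau.ext fun i j => ?_
  by_cases hc : (i, j) ∈ lam
  · rw [h i j hc]
    exact (if_pos hc).symm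
  · rw [T.zeros hc, SemistandardYoungTableau.zeros _ hc]

theorem sum_smul_schurFun_apply {R : Type} [CommRing R] (a : YoungDiagram →₀ R) (m : ℕ →₀ ℕ) :
    (a.sum fun lam x => x • schurFun R lam) m = a.sum fun lam x => x * (kostka lam m : R) := by
  simp only [Finsupp.sum]
  exact Finset.sum_apply m a.support fun lam => a lam • schurFun R lam

/-- Choose `lam` in the support with least `rowIndexSum` and look at the monomial of its highest
weight tableau. No other shape in the support contributes to it, so the coefficient of `lam` would
be zero. -/
theorem eq_zero_of_sum_smul_schurFun {R : Type} [CommRing R] (a : YoungDiagram →₀ R)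
    (h : (a.sum fun lam x => x • schurFun R lam) = 0) : a = 0 := by
  by_contra hne
  obtain ⟨lam, hlam, hmin⟩ := a.support.exists_min_image rowIndexSum
    (Finsupp.support_nonempty_iff.2 hne)
  have h1 := sum_smul_schurFun_apply a
    (tableauContent (SemistandardYoungTableau.highestWeight lam))
  rw [h, Finsupp.sum, Finset.sum_eq_single lam, kostka_self, Nat.cast_one, mul_one] at h1
  · exact Finsupp.mem_support_iff.1 hlam h1.symm
  · intro μ hμ hμne
    have h2 : kostka μ (tableauContent (SemistandardYoungTableau.highestWeight lam)) = 0 := by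
      rw [kostka, Set.ncard_eq_zero (finite_tableaux_of_content _ _),
        Set.eq_empty_iff_forall_notMem]
      intro T hT
      exact hμne ((rowIndexSum_le_and_eq T hT).2 (hmin μ hμ)).1
    rw [h2, Nat.cast_zero, mul_zero]
  · exact fun h' => absurd hlam h'

theorem sum_smul_schurFun_injective {R : Type} [CommRing R] (a b : YoungDiagram →₀ R)
    (h : (a.sum fun lam x => x • schurFun R lam) = b.sum fun lam x => x • schurFun R lam) :
    a = b := by
  refine sub_eq_zero.1 (eq_zero_of_sum_smul_schurFun _ ?_)
  rw [Finsupp.sum_sub_index fun _ _ _ => sub_smul _ _ _, h, sub_self]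


/-! ### Monomials -/

section Monomials

variable {N : ℕ}

theorem monom_eq_single (w : Word N) : monom QField w = MonoidAlgebra.single w 1 := rfl

theorem monom_mul (v w : Word N) : monom QField (v * w) = monom QField v * monom QField w :=
  map_mul (MonoidAlgebra.of QField (Word N)) v w

theorem monom_one : monom QField (1 : Word N) = 1 := rfl

theorem coeff_monom (v w : Word N) [Decidable (v = w)] :
    (monom QField v).coeff w = if v = w then 1 else 0 := by
  rw [monom_eq_single, MonoidAlgebra.coeff_single, Finsupp.single_apply]

theorem monom_ofList (l : List (Fin N)) : monom QField (FreeMonoid.ofList l) = (l.map uVar).prod := by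
  induction l with
  | nil => rfl
  | cons a l ih =>
    rw [List.map_cons, List.prod_cons, ← ih, uVar, ← monom_mul]
    rfl

theorem coeff_mul_monom_append (g : NCPoly QField N) (x w : Word N) :
    (g * monom QField w).coeff (x * w) = g.coeff x := by
  rw [monom_eq_single, MonoidAlgebra.coeff_mul_single_eq_coeff_mul x, mul_one]
  intro m' _
  exact mul_left_inj w

theorem coeff_mul_monom_of_forall_ne (g : NCPoly QField N) (v w : Word N) (h : ∀ x, x * w ≠ v) :
    (g * monom QField w).coeff v = 0 := by
  rw [monom_eq_single]
  exact MonoidAlgebra.coeff_mul_single_of_forall_mul_ne _ _ h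

/-- The noncommutative elementary symmetric functions of the variables `u_a`. -/
theorem ncElem_eq_ncE (d : ℕ) : ncElem QField N (d : ℤ) = ncE uVar Finset.univ d := by
  rw [ncElem, if_neg (by omega), ncE, Int.toNat_natCast]
  exact Finset.sum_congr rfl fun S _ => monom_ofList _

theorem ncH_uVar (d : ℕ) : ncH uVar (Finset.univ : Finset (Fin N)) d =
    ∑ S ∈ Finset.powersetCard d Finset.univ, monom QField (FreeMonoid.ofList (S.sort (· ≤ ·))) := by
  rw [ncH]
  exact Finset.sum_congr rfl fun S _ => (monom_ofList _).symm

end Monomials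

/-! ### Coefficients of the fundamental quasisymmetric functions -/

section QuasiSymmetric

variable {N : ℕ}

/-- The weakly increasing list with `m i` entries `i`, for `i < p`. -/
def blockList (m : ℕ →₀ ℕ) (p : ℕ) : List ℕ := (List.range p).flatMap fun i => List.replicate (m i) i

theorem blockList_succ (m : ℕ →₀ ℕ) (p : ℕ) :
    blockList m (p + 1) = blockList m p ++ List.replicate (m p) p := by
  simp [blockList, List.range_succ]

theorem lt_of_mem_blockList {m : ℕ →₀ ℕ} {p i : ℕ} (h : i ∈ blockList m p) : i < p := by
  simp only [blockList, List.mem_flatMap, List.mem_range, List.mem_replicate] at h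
  obtain ⟨j, hj, -, rfl⟩ := h
  exact hj

theorem pairwise_blockList (m : ℕ →₀ ℕ) (p : ℕ) : (blockList m p).Pairwise (· ≤ ·) := by
  induction p with
  | zero => simp [blockList]
  | succ p ih =>
    rw [blockList_succ, List.pairwise_append]
    refine ⟨ih, List.pairwise_replicate_of_refl, fun a ha b hb => ?_⟩
    rw [List.eq_of_mem_replicate hb]
    exact (lt_of_mem_blockList ha).le

theorem count_blockList (m : ℕ →₀ ℕ) (p j : ℕ) :
    (blockList m p).count j = if j < p then m j else 0 := by
  induction p with
  | zero => simp [blockList]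
  | succ p ih =>
    rw [blockList_succ, List.count_append, ih, List.count_replicate]
    rcases lt_trichotomy j p with h | rfl | h
    · simp [h, h.ne', h.trans (Nat.lt_succ_self p)]
    · simp
    · simp [h.ne, h.not_gt, Nat.not_lt.2 (Nat.succ_le_of_lt h)]

/-- The list `l` is a concatenation of strictly increasing lists of lengths `m 0, …, m (p - 1)`. -/
def IncreasingBlocks (m : ℕ →₀ ℕ) (p : ℕ) (l : List (Fin N)) : Prop :=
  l.length = (blockList m p).length ∧ ((blockList m p).zip l).Pairwise (Prod.Lex (· < ·) (· < ·))

/-- In the lexicographic order the block index decides between different blocks, so the only new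
condition is the one inside the last block. -/
theorem increasingBlocks_append (m : ℕ →₀ ℕ) (p : ℕ) (l l' : List (Fin N)) (h : l'.length = m p) :
    IncreasingBlocks m (p + 1) (l ++ l') ↔ IncreasingBlocks m p l ∧ l'.Pairwise (· < ·) := by
  have hlen : (l ++ l').length = (blockList m (p + 1)).length ↔
      l.length = (blockList m p).length := by
    rw [blockList_succ, List.length_append, List.length_append, List.length_replicate, h,
      Nat.add_right_cancel_iff]
  rw [IncreasingBlocks, IncreasingBlocks, hlen, and_assoc]
  refine and_congr_right fun hl => ?_
  rw [blockList_succ, List.zip_append hl.symm, List.pairwise_append]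
  have h1 : (List.replicate (m p) p).zip l' = l'.map (Prod.mk p) := by
    rw [← h]
    clear h hlen
    induction l' with
    | nil => rfl
    | cons a l' ih => rw [List.length_cons, List.replicate_succ, List.zip_cons_cons, ih, List.map_cons]
  rw [h1, List.pairwise_map]
  constructor
  · rintro ⟨h2, h3, -⟩
    refine ⟨h2, h3.imp fun {a b} hab => ?_⟩
    simpa [Prod.lex_def] using hab
  · rintro ⟨h2, h3⟩
    refine ⟨h2, h3.imp fun {a b} hab => by simpa [Prod.lex_def] using hab, ?_⟩
    intro x hx y hy
    rw [List.mem_map] at hy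
    obtain ⟨b, -, rfl⟩ := hy
    rw [Prod.lex_def]
    exact Or.inl (lt_of_mem_blockList (List.of_mem_zip (a := x.1) (b := x.2) hx).1)

open scoped Classical in
-- The lengths prescribe where a word is cut, and an increasing block is determined by its set of
-- letters. So a word arises from at most one choice of sets.
theorem coeff_prod_ncH (m : ℕ →₀ ℕ) (p : ℕ) : ∀ l : List (Fin N),
    ((List.range p).map fun i => ncH uVar (Finset.univ : Finset (Fin N)) (m i)).prod.coeff
      (FreeMonoid.ofList l) = if IncreasingBlocks m p l then 1 else 0 := by
  induction p with
  | zero =>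
    intro l
    have h1 : IncreasingBlocks m 0 l ↔ (1 : Word N) = FreeMonoid.ofList l := by
      simp only [IncreasingBlocks, blockList, List.range_zero, List.flatMap_nil, List.length_nil,
        List.length_eq_zero_iff, List.zip_nil_left, List.Pairwise.nil, and_true]
      exact eq_comm
    rw [List.range_zero, List.map_nil, List.prod_nil, ← monom_one, coeff_monom]
    simp only [h1]
  | succ p ih =>
    intro l
    rw [List.range_succ, List.map_append, List.prod_append, List.map_singleton, List.prod_singleton,
      ncH_uVar, Finset.mul_sum, MonoidAlgebra.coeff_sum, Finsupp.finsetSum_apply]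
    have hlen : ∀ S ∈ Finset.powersetCard (m p) (Finset.univ : Finset (Fin N)),
        (S.sort (· ≤ ·)).length = m p := by
      intro S hS
      rw [Finset.length_sort, (Finset.mem_powersetCard.1 hS).2]
    have hsort : ∀ S : Finset (Fin N), (S.sort (· ≤ ·)).Pairwise (· < ·) := fun S =>
      (Finset.sortedLT_sort S).pairwise
    split_ifs with hgood
    · obtain ⟨l, l', rfl, hl'⟩ : ∃ l₁ l₂ : List (Fin N), l = l₁ ++ l₂ ∧ l₂.length = m p := by
        refine ⟨l.take (blockList m p).length, l.drop (blockList m p).length,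
          (List.take_append_drop _ _).symm, ?_⟩
        have h1 := hgood.1
        rw [blockList_succ, List.length_append, List.length_replicate] at h1
        rw [List.length_drop]
        omega
      have hg := (increasingBlocks_append m p l l' hl').1 hgood
      have hS : (l'.toFinset.sort (· ≤ ·)) = l' := by
        refine List.Perm.eq_of_pairwise' (r := (· ≤ ·)) (Finset.pairwise_sort _ _)
          (hg.2.imp fun h => h.le) ?_
        rw [← Multiset.coe_eq_coe, Finset.sort_eq, List.toFinset_val,
          List.Nodup.dedup (hg.2.imp fun h => h.ne)]
      rw [Finset.sum_eq_single l'.toFinset]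
      · rw [hS, FreeMonoid.ofList_append, coeff_mul_monom_append, ih, if_pos hg.1]
      · intro S hS' hne
        refine coeff_mul_monom_of_forall_ne _ _ _ fun x hx => hne ?_
        have h1 : x.toList ++ S.sort (· ≤ ·) = l ++ l' := hx
        have h2 := (List.append_inj' h1 (by rw [hlen S hS', hl'])).2
        rw [← h2, Finset.sort_toFinset]
      · intro h
        refine absurd (Finset.mem_powersetCard.2 ⟨Finset.subset_univ _, ?_⟩) h
        rw [← hl', List.toFinset_card_of_nodup (hg.2.imp fun h => h.ne)]
    · refine Finset.sum_eq_zero fun S hS => ?_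
      by_cases hx : ∃ x : List (Fin N), l = x ++ S.sort (· ≤ ·)
      · obtain ⟨x, rfl⟩ := hx
        rw [increasingBlocks_append m p x _ (hlen S hS)] at hgood
        rw [FreeMonoid.ofList_append, coeff_mul_monom_append, ih,
          if_neg fun h => hgood ⟨h, hsort S⟩]
      · exact coeff_mul_monom_of_forall_ne _ _ _ fun x h => hx ⟨x.toList, h.symm⟩

theorem sum_single_apply {n : ℕ} (i : Fin n → ℕ) (t : ℕ) :
    (∑ j, Finsupp.single (i j) 1 : ℕ →₀ ℕ) t = (List.ofFn i).count t := by
  have h : Finsupp.toMultiset (∑ j, Finsupp.single (i j) 1) = (List.ofFn i : Multiset ℕ) := by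
    simp only [Finsupp.toMultiset_sum, Finsupp.toMultiset_single, one_smul]
    rw [← Fin.univ_val_map, ← Multiset.sum_map_singleton (Multiset.map i _), Multiset.map_map]
    rfl
  rw [← Finsupp.count_toMultiset, h, Multiset.coe_count]

theorem ofFn_eq_blockList {n : ℕ} (i : Fin n → ℕ) (hi : Monotone i) (m : ℕ →₀ ℕ) (p : ℕ)
    (hm : ∀ j, p ≤ j → m j = 0) (h : ∑ j, Finsupp.single (i j) 1 = m) :
    List.ofFn i = blockList m p := by
  refine List.Perm.eq_of_pairwise' (r := (· ≤ ·)) ?_ (pairwise_blockList m p) ?_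
  · rw [List.pairwise_ofFn]
    exact fun a b hab => hi hab.le
  · rw [List.perm_iff_count]
    intro j
    rw [count_blockList, ← sum_single_apply, h]
    split_ifs with hj
    · rfl
    · exact hm j (not_lt.1 hj)

open scoped Classical in
-- Only one weakly increasing index sequence has content `m`, namely `blockList m p`. It is
-- admissible exactly if descents of `v` occur only between blocks; as `v` has no repeated letters,
-- each block is then strictly increasing.
theorem wordQSym_apply (v : Word N) (hv : v.toList.Nodup) (m : ℕ →₀ ℕ) (p : ℕ)
    (hm : ∀ j, p ≤ j → m j = 0) :
    wordQSym QField v m = if IncreasingBlocks m p v.toList then 1 else 0 := by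
  have key : ∀ i : Fin v.toList.length → ℕ, List.ofFn i = blockList m p →
      (((blockList m p).zip v.toList).Pairwise (Prod.Lex (· < ·) (· < ·)) ↔ Monotone i ∧
        ∀ j j' : Fin v.toList.length, (j' : ℕ) = (j : ℕ) + 1 → (j : ℕ) ∈ descents v → i j < i j') := by
    intro i hi
    have hzip : (blockList m p).zip v.toList = List.ofFn fun j => (i j, v.toList.get j) := by
      rw [← hi]
      refine List.ext_getElem (by simp) fun n h1 h2 => ?_
      simp
    rw [hzip, List.pairwise_ofFn]
    constructor
    · intro h
      refine ⟨fun a b hab => ?_, fun j j' hjj hj => ?_⟩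
      · rcases hab.eq_or_lt with rfl | hab
        · exact le_rfl
        · rcases Prod.lex_def.1 (h hab) with h1 | h1
          · exact h1.le
          · exact h1.1.le
      · rcases Prod.lex_def.1 (h (show j < j' by rw [Fin.lt_def]; omega)) with h1 | h1
        · exact h1
        · obtain ⟨hlt, h2⟩ := hj
          have h3 := h1.2
          simp only [List.get_eq_getElem, hjj] at h3
          exact absurd h3 h2.not_gt
    · rintro ⟨h1, h2⟩
      have h3 : ∀ j j' : Fin v.toList.length, (j' : ℕ) = (j : ℕ) + 1 →
          Prod.Lex (· < ·) (· < ·) (i j, v.toList.get j) (i j', v.toList.get j') := by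
        intro j j' hjj
        rw [Prod.lex_def]
        have hlt : j < j' := by rw [Fin.lt_def]; omega
        rcases (h1 hlt.le).lt_or_eq with h4 | h4
        · exact Or.inl h4
        · refine Or.inr ⟨h4, ?_⟩
          by_contra hge
          have hne : v.toList.get j' ≠ v.toList.get j := fun h =>
            hlt.ne (List.nodup_iff_injective_get.1 hv h).symm
          have h5 : v.toList.get j' < v.toList.get j := lt_of_le_of_ne (not_lt.1 hge) hne
          refine absurd (h2 j j' hjj ⟨by have := j'.2; omega, ?_⟩) (by rw [h4]; exact lt_irrefl _)
          simpa only [List.get_eq_getElem, hjj] using h5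
      -- Transitivity of the lexicographic order extends the comparison from adjacent positions to
      -- all pairs.
      have h4 : ∀ d, ∀ j j' : Fin v.toList.length, (j' : ℕ) = (j : ℕ) + d + 1 →
          Prod.Lex (· < ·) (· < ·) (i j, v.toList.get j) (i j', v.toList.get j') := by
        intro d
        induction d with
        | zero => exact h3
        | succ d ih =>
          intro j j' hjj
          have hlt : (j : ℕ) + d + 1 < v.toList.length := by have := j'.2; omega
          exact _root_.trans (ih j ⟨j + d + 1, hlt⟩ rfl) (h3 ⟨j + d + 1, hlt⟩ j' hjj)
      intro a b hab
      exact h4 ((b : ℕ) - a - 1) a b (by rw [Fin.lt_def] at hab; omega)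
  obtain ⟨A, hA, hmem⟩ : ∃ A : Set (Fin v.toList.length → ℕ),
      wordQSym QField v m = (A.ncard : QField) ∧ ∀ i, i ∈ A ↔ Monotone i ∧
        (∀ j j' : Fin v.toList.length, (j' : ℕ) = (j : ℕ) + 1 → (j : ℕ) ∈ descents v → i j < i j') ∧
        ∑ j, Finsupp.single (i j) 1 = m := ⟨_, rfl, fun _ => Iff.rfl⟩
  rw [hA]
  split_ifs with hgood
  · obtain ⟨i, hi⟩ : ∃ i : Fin v.toList.length → ℕ, List.ofFn i = blockList m p := by
      refine ⟨fun j => (blockList m p).get (Fin.cast hgood.1 j), ?_⟩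
      refine List.ext_getElem (by simp [hgood.1]) fun n h1 h2 => ?_
      simp
    have hi' := (key i hi).1 hgood.2
    have hc : ∑ j, Finsupp.single (i j) 1 = m := by
      ext t
      rw [sum_single_apply, hi, count_blockList]
      split_ifs with ht
      · rfl
      · exact (hm t (not_lt.1 ht)).symm
    have hsing : A = {i} := by
      refine Set.eq_singleton_iff_unique_mem.2 ⟨(hmem i).2 ⟨hi'.1, hi'.2, hc⟩, fun i' hi'' => ?_⟩
      rw [hmem] at hi''
      refine List.ofFn_injective ?_
      rw [hi, ofFn_eq_blockList i' hi''.1 m p hm hi''.2.2]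
    rw [hsing, Set.ncard_singleton, Nat.cast_one]
  · have hempty : A = ∅ := by
      refine Set.eq_empty_iff_forall_notMem.2 fun i hi => ?_
      obtain ⟨h1, h2, h3⟩ := (hmem i).1 hi
      have hi := ofFn_eq_blockList i h1 m p hm h3
      refine hgood ⟨?_, (key i hi).2 ⟨h1, h2⟩⟩
      rw [← hi, List.length_ofFn]
    rw [hempty, Set.ncard_empty, Nat.cast_zero]

end QuasiSymmetric


/-! ### Orthogonality to Lam's relations -/

section PairSublist

variable {α : Type*}

/-- Two-letter sublists record relative order without positions, so they can be compared before and
after a transposition without reindexing. -/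
theorem pair_sublist_iff_get {l : List α} {c d : α} :
    [c, d].Sublist l ↔ ∃ p r : Fin l.length, p < r ∧ l.get p = c ∧ l.get r = d := by
  constructor
  · have h : l.Pairwise fun a b => ∃ p r : Fin l.length, p < r ∧ l.get p = a ∧ l.get r = b :=
      List.pairwise_iff_get.2 fun p r hpr => ⟨p, r, hpr, rfl, rfl⟩
    exact fun hs => List.pairwise_iff_forall_sublist.1 h hs
  · rintro ⟨p, r, hpr, rfl, rfl⟩
    have h : l.Pairwise fun a b => [a, b].Sublist l :=
      List.pairwise_iff_forall_sublist.2 fun hs => hs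
    exact List.pairwise_iff_get.1 h p r hpr

theorem pair_sublist_cons {l : List α} {c d e : α} :
    [c, d].Sublist (e :: l) ↔ [c, d].Sublist l ∨ c = e ∧ d ∈ l := by
  rw [List.cons_sublist_cons']
  simp

theorem pair_sublist_append {l l' : List α} {c d : α} : [c, d].Sublist (l ++ l') ↔
    [c, d].Sublist l ∨ [c, d].Sublist l' ∨ c ∈ l ∧ d ∈ l' := by
  induction l with
  | nil => simp
  | cons e l ih =>
    rw [List.cons_append, pair_sublist_cons, pair_sublist_cons, ih, List.mem_append, List.mem_cons]
    tauto

theorem pair_sublist_swap {x y : List α} {a b c d : α} (h1 : ¬ (c = a ∧ d = b))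
    (h2 : ¬ (c = b ∧ d = a)) :
    [c, d].Sublist (x ++ a :: b :: y) ↔ [c, d].Sublist (x ++ b :: a :: y) := by
  simp only [pair_sublist_append, pair_sublist_cons, List.mem_cons]
  tauto

theorem perm_swap_append (x y : List α) (a b : α) : (x ++ a :: b :: y).Perm (x ++ b :: a :: y) :=
  (List.Perm.swap b a y).append_left x

end PairSublist

section Orthogonality

variable {N : ℕ}

theorem occursBefore_iff {v : Word N} {s t : ℤ} : OccursBefore v s t ↔
    ∃ c d : Fin N, letter c = s ∧ letter d = t ∧ [c, d].Sublist v.toList := by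
  constructor
  · rintro ⟨p, r, hpr, rfl, rfl⟩
    exact ⟨_, _, rfl, rfl, pair_sublist_iff_get.2 ⟨p, r, hpr, rfl, rfl⟩⟩
  · rintro ⟨c, d, rfl, rfl, h⟩
    obtain ⟨p, r, hpr, rfl, rfl⟩ := pair_sublist_iff_get.1 h
    exact ⟨p, r, hpr, rfl, rfl⟩

open scoped Classical in
/-- The pairs of letters that contribute to `kInv`. -/
def kInvPairs (k : ℕ) (v : Word N) : Finset (Fin N × Fin N) :=
  Finset.univ.filter fun c => [c.1, c.2].Sublist v.toList ∧ 0 < letter c.1 - letter c.2 ∧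
    letter c.1 - letter c.2 < (k : ℤ)

theorem mem_kInvPairs (k : ℕ) (v : Word N) (c d : Fin N) : (c, d) ∈ kInvPairs k v ↔
    [c, d].Sublist v.toList ∧ 0 < letter c - letter d ∧ letter c - letter d < (k : ℤ) := by
  simp only [kInvPairs, Finset.mem_filter, Finset.mem_univ, true_and]

theorem kInv_eq_card (k : ℕ) {v : Word N} (hv : v.toList.Nodup) :
    kInv k v = (kInvPairs k v).card := by
  have hinj := List.nodup_iff_injective_get.1 hv
  rw [kInv]
  refine Finset.card_bij (fun p _ => (v.toList.get p.1, v.toList.get p.2)) ?_ ?_ ?_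
  · rintro ⟨p, r⟩ hp
    simp only [Finset.mem_filter, Finset.mem_univ, true_and] at hp
    simp only [kInvPairs, Finset.mem_filter, Finset.mem_univ, true_and]
    exact ⟨pair_sublist_iff_get.2 ⟨p, r, hp.1, rfl, rfl⟩, hp.2⟩
  · rintro ⟨p, r⟩ _ ⟨p', r'⟩ _ h
    rw [Prod.mk_inj] at h
    exact Prod.ext (hinj h.1) (hinj h.2)
  · rintro ⟨c, d⟩ hc
    simp only [kInvPairs, Finset.mem_filter, Finset.mem_univ, true_and] at hc
    obtain ⟨p, r, hpr, rfl, rfl⟩ := pair_sublist_iff_get.1 hc.1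
    refine ⟨(p, r), ?_, rfl⟩
    simp only [Finset.mem_filter, Finset.mem_univ, true_and]
    exact ⟨hpr, hc.2⟩

/-- Only the relative order of `a` and `b` changes, and these letters are too far apart to count in
either order. -/
theorem kInv_swap_of_far (k : ℕ) {x y : List (Fin N)} {a b : Fin N}
    (hv : (x ++ a :: b :: y).Nodup) (h : letter b - letter a > (k : ℤ)) :
    kInv k (FreeMonoid.ofList (x ++ a :: b :: y)) =
      kInv k (FreeMonoid.ofList (x ++ b :: a :: y)) := by
  rw [kInv_eq_card k (v := FreeMonoid.ofList (x ++ a :: b :: y)) hv,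
    kInv_eq_card k (v := FreeMonoid.ofList (x ++ b :: a :: y))
      ((perm_swap_append x y a b).nodup hv)]
  congr 1
  ext ⟨c, d⟩
  rw [mem_kInvPairs, mem_kInvPairs]
  refine and_congr_left fun hcd => pair_sublist_swap ?_ ?_
  · rintro ⟨rfl, rfl⟩
    omega
  · rintro ⟨rfl, rfl⟩
    omega

/-- The pair `(b, a)` is the single new inversion; in the order `a, b` the difference is negative
and does not count. -/
theorem kInv_swap_of_near (k : ℕ) {x y : List (Fin N)} {a b : Fin N}
    (hv : (x ++ a :: b :: y).Nodup) (h : 0 < letter b - letter a)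
    (h' : letter b - letter a < (k : ℤ)) :
    kInv k (FreeMonoid.ofList (x ++ b :: a :: y)) =
      kInv k (FreeMonoid.ofList (x ++ a :: b :: y)) + 1 := by
  classical
  rw [kInv_eq_card k (v := FreeMonoid.ofList (x ++ a :: b :: y)) hv,
    kInv_eq_card k (v := FreeMonoid.ofList (x ++ b :: a :: y))
      ((perm_swap_append x y a b).nodup hv)]
  have hsub : [b, a].Sublist (x ++ b :: a :: y) := by
    simp only [pair_sublist_append, pair_sublist_cons, List.mem_cons]
    tauto
  have hnot : ¬ [b, a].Sublist (x ++ a :: b :: y) := by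
    intro h1
    have h2 : [a, b].Sublist (x ++ a :: b :: y) := by
      simp only [pair_sublist_append, pair_sublist_cons, List.mem_cons]
      tauto
    obtain ⟨p, r, hpr, hp, hr⟩ := pair_sublist_iff_get.1 h1
    obtain ⟨p', r', hpr', hp', hr'⟩ := pair_sublist_iff_get.1 h2
    have hinj := List.nodup_iff_injective_get.1 hv
    have h3 := hinj (hp.trans hr'.symm)
    have h4 := hinj (hr.trans hp'.symm)
    subst h3 h4
    exact absurd hpr hpr'.not_gt
  rw [← Finset.card_insert_of_notMem (a := (b, a))
    (s := kInvPairs k (FreeMonoid.ofList (x ++ a :: b :: y)))]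
  · congr 1
    ext ⟨c, d⟩
    rw [Finset.mem_insert, mem_kInvPairs, mem_kInvPairs, Prod.mk_inj]
    by_cases h1 : c = b ∧ d = a
    · obtain ⟨rfl, rfl⟩ := h1
      exact ⟨fun _ => Or.inl ⟨rfl, rfl⟩, fun _ => ⟨hsub, h, h'⟩⟩
    · simp only [h1, false_or]
      refine and_congr_left fun hcd => pair_sublist_swap h1 ?_
      rintro ⟨rfl, rfl⟩
      omega
  · rw [mem_kInvPairs]
    exact fun h1 => hnot h1.1

theorem neighbours_diff (b : SkewShapeWithContents) (p : ℤ × ℤ) (hp : p ∈ b.neighbours) :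
    p.2 = p.1 + 1 ∨ p.2 = p.1 - 1 := by
  induction b using Quotient.inductionOn with
  | h s =>
    have hp : p ∈ s.neighbours := hp
    obtain ⟨z, -, z', -, h, rfl⟩ := hp
    simp only [SkewShape.East, SkewShape.South, SkewShape.content] at h ⊢
    omega

variable {k : ℕ} (β : Fin k → SkewShapeWithContents)

theorem mem_lltWords {v : Word N} : v ∈ lltWords N β ↔ v ∈ lltWordSet N β := by
  simp [lltWords]

/-- Each order condition concerns two letters that differ by exactly `k`, hence never the exchanged
pair. -/
theorem lltWordSet_of_swap {x y : List (Fin N)} {a b : Fin N}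
    (h : letter b - letter a ≠ k) (h' : letter a - letter b ≠ k)
    (hv : FreeMonoid.ofList (x ++ a :: b :: y) ∈ lltWordSet N β) :
    FreeMonoid.ofList (x ++ b :: a :: y) ∈ lltWordSet N β := by
  obtain ⟨h1, h2, h3⟩ := hv
  have hperm := perm_swap_append x y a b
  refine ⟨hperm.nodup h1, ?_, fun i p hp => ?_⟩
  · rw [← h2]
    exact Multiset.coe_eq_coe.2 (hperm.symm.map letter)
  · obtain ⟨c, d, hc, hd, hs⟩ := occursBefore_iff.1 (h3 i p hp)
    refine occursBefore_iff.2 ⟨c, d, hc, hd, ?_⟩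
    have hdiff : letter d - letter c = k ∨ letter c - letter d = k := by
      rw [hc, hd]
      simp only [shifted]
      rcases neighbours_diff (β i) p hp with h4 | h4 <;> rw [h4]
      · left; ring
      · right; ring
    refine (pair_sublist_swap ?_ ?_).1 hs
    · rintro ⟨rfl, rfl⟩
      tauto
    · rintro ⟨rfl, rfl⟩
      tauto

theorem lltWords_swap {x y : List (Fin N)} {a b : Fin N}
    (h : letter b - letter a ≠ k) (h' : letter a - letter b ≠ k) :
    FreeMonoid.ofList (x ++ a :: b :: y) ∈ lltWords N β ↔
      FreeMonoid.ofList (x ++ b :: a :: y) ∈ lltWords N β := by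
  rw [mem_lltWords, mem_lltWords]
  exact ⟨lltWordSet_of_swap β h h', lltWordSet_of_swap β h' h⟩

open scoped Classical in
theorem coeff_lltElement (v : Word N) :
    (lltElement N β).coeff v = if v ∈ lltWords N β then qq ^ kInv k v else 0 := by
  rw [lltElement, MonoidAlgebra.coeff_sum, Finsupp.finsetSum_apply]
  simp only [MonoidAlgebra.coeff_smul, Finsupp.smul_apply, coeff_monom, smul_eq_mul, mul_ite,
    mul_one, mul_zero]
  rw [Finset.sum_ite_eq' (lltWords N β) v fun w => qq ^ kInv k w]

theorem wordPairing_monom (v : Word N) (g : NCPoly QField N) :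
    wordPairing QField N (monom QField v) g = g.coeff v := by
  have h : wordPairing QField N (monom QField v) g =
      (monom QField v).coeff.sum fun w a => a * g.coeff w := rfl
  rw [h, monom_eq_single, MonoidAlgebra.coeff_single, Finsupp.sum_single_index (zero_mul _), one_mul]

theorem wordPairing_lltElement (z : NCPoly QField N) : wordPairing QField N z (lltElement N β) =
    ∑ v ∈ lltWords N β, qq ^ kInv k v * z.coeff v := by
  induction z using MonoidAlgebra.induction_linear with
  | zero => simp
  | add f g hf hg =>
    rw [map_add, LinearMap.add_apply, hf, hg, ← Finset.sum_add_distrib]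
    refine Finset.sum_congr rfl fun v _ => ?_
    rw [MonoidAlgebra.coeff_add, Finsupp.add_apply, mul_add]
  | single w r =>
    classical
    have h : MonoidAlgebra.single w r = r • monom QField w := by
      rw [monom_eq_single, MonoidAlgebra.smul_single, smul_eq_mul, mul_one]
    rw [h, map_smul, LinearMap.smul_apply, wordPairing_monom, coeff_lltElement]
    simp only [MonoidAlgebra.coeff_smul, Finsupp.smul_apply, coeff_monom, smul_eq_mul, mul_ite,
      mul_one, mul_zero]
    rw [Finset.sum_ite_eq (lltWords N β) w fun v => qq ^ kInv k v * r]
    split_ifs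
    · exact mul_comm _ _
    · rfl

theorem qq_ne_zero : qq ≠ 0 := RatFunc.X_ne_zero

theorem coeff_lltElement_swap_of_far {x y : List (Fin N)} {a b : Fin N}
    (h : letter b - letter a > (k : ℤ)) :
    (lltElement N β).coeff (FreeMonoid.ofList (x ++ a :: b :: y)) =
      (lltElement N β).coeff (FreeMonoid.ofList (x ++ b :: a :: y)) := by
  classical
  have hswap := lltWords_swap β (x := x) (y := y) (a := a) (b := b) (by omega) (by omega)
  rw [coeff_lltElement, coeff_lltElement]
  simp only [← hswap]
  split_ifs with hv
  · rw [kInv_swap_of_far k ((mem_lltWords β).1 hv).1 h]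
  · rfl

theorem coeff_lltElement_swap_of_near {x y : List (Fin N)} {a b : Fin N}
    (h : 0 < letter b - letter a) (h' : letter b - letter a < (k : ℤ)) :
    (lltElement N β).coeff (FreeMonoid.ofList (x ++ a :: b :: y)) =
      qq⁻¹ * (lltElement N β).coeff (FreeMonoid.ofList (x ++ b :: a :: y)) := by
  classical
  have hswap := lltWords_swap β (x := x) (y := y) (a := a) (b := b) (by omega) (by omega)
  rw [coeff_lltElement, coeff_lltElement]
  simp only [← hswap]
  split_ifs with hv
  · rw [kInv_swap_of_near k ((mem_lltWords β).1 hv).1 h h', pow_succ', ← mul_assoc,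
      inv_mul_cancel₀ qq_ne_zero, one_mul]
  · rw [mul_zero]

theorem coeff_lltElement_of_not_nodup {v : Word N} (h : ¬ v.toList.Nodup) :
    (lltElement N β).coeff v = 0 := by
  classical
  rw [coeff_lltElement, if_neg fun hv => h ((mem_lltWords β).1 hv).1]

theorem monom_mul_uVar_mul_uVar_mul_monom (x y : Word N) (a b : Fin N) :
    monom QField x * (uVar a * uVar b) * monom QField y =
      monom QField (FreeMonoid.ofList (x.toList ++ a :: b :: y.toList)) := by
  rw [uVar, uVar, ← monom_mul, ← monom_mul, ← monom_mul, mul_assoc]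
  rfl

theorem wordPairing_generator {z : NCPoly QField N} (hz : z ∈ lamRelations k N) (x y : Word N) :
    wordPairing QField N (monom QField x * z * monom QField y) (lltElement N β) = 0 := by
  rcases hz with (⟨a, c, h, rfl⟩ | ⟨a, b, h, h', rfl⟩) | ⟨w, hw, rfl⟩
  · rw [mul_sub, sub_mul, monom_mul_uVar_mul_uVar_mul_monom, monom_mul_uVar_mul_uVar_mul_monom,
      map_sub, LinearMap.sub_apply, wordPairing_monom, wordPairing_monom,
      coeff_lltElement_swap_of_far β h, sub_self]
  · rw [mul_sub, sub_mul, mul_smul_comm, smul_mul_assoc, monom_mul_uVar_mul_uVar_mul_monom,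
      monom_mul_uVar_mul_uVar_mul_monom, map_sub, map_smul, LinearMap.sub_apply,
      LinearMap.smul_apply, wordPairing_monom, wordPairing_monom,
      coeff_lltElement_swap_of_near β h h', smul_eq_mul, sub_self]
  · rw [← monom_mul, ← monom_mul, wordPairing_monom]
    refine coeff_lltElement_of_not_nodup β fun h => hw ?_
    refine List.Nodup.sublist ?_ h
    rw [FreeMonoid.toList_mul, FreeMonoid.toList_mul]
    exact (List.sublist_append_right _ _).trans (List.sublist_append_left _ _)

theorem lltElement_mem_orthogonalComplement :
    lltElement N β ∈ orthogonalComplement (lamIdeal k N) := by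
  -- The factors `x` and `y` make the claim stable under multiplication on either side, as induction
  -- over the generated ideal needs. For generators, bilinearity reduces them to monomials.
  have key : ∀ z ∈ lamIdeal k N, ∀ x y : NCPoly QField N,
      wordPairing QField N (x * z * y) (lltElement N β) = 0 := by
    intro z hz
    refine TwoSidedIdeal.span_induction (s := lamRelations k N)
      (p := fun z _ => ∀ x y, wordPairing QField N (x * z * y) (lltElement N β) = 0)
      ?_ ?_ ?_ ?_ ?_ ?_ hz
    · intro z hz x y
      induction x using MonoidAlgebra.induction_linear with
      | zero => simp
      | add f g hf hg => rw [add_mul, add_mul, map_add, LinearMap.add_apply, hf, hg, add_zero]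
      | single v r =>
        induction y using MonoidAlgebra.induction_linear with
        | zero => simp
        | add f g hf hg => rw [mul_add, map_add, LinearMap.add_apply, hf, hg, add_zero]
        | single w s =>
          have h : ∀ (v : Word N) (r : QField),
              (MonoidAlgebra.single v r : NCPoly QField N) = r • monom QField v := by
            intro v r
            rw [monom_eq_single, MonoidAlgebra.smul_single, smul_eq_mul, mul_one]
          rw [h, h, smul_mul_assoc, smul_mul_assoc, mul_smul_comm, map_smul, map_smul,
            LinearMap.smul_apply, LinearMap.smul_apply, wordPairing_generator β hz, smul_zero,
            smul_zero]
    · intro x y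
      simp
    · intro z z' _ _ h h' x y
      rw [mul_add, add_mul, map_add, LinearMap.add_apply, h, h', add_zero]
    · intro z _ h x y
      rw [mul_neg, neg_mul, map_neg, LinearMap.neg_apply, h, neg_zero]
    · intro c z _ h x y
      rw [← mul_assoc, h]
    · intro c z _ h x y
      rw [← mul_assoc, mul_assoc _ c y, h]
  intro z hz
  simpa using key z hz 1 1

end Orthogonality


open YoungDiagram

/-! ### The commutative ring generated by the elementary symmetric functions -/

theorem map_ncE {α A B : Type*} [LinearOrder α] [Ring A] [Ring B] (f : A →+* B) (u : α → A)
    (S : Finset α) (d : ℕ) : f (ncE u S d) = ncE (fun a => f (u a)) S d := by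
  simp only [ncE, map_sum, map_list_prod, List.map_map]
  rfl

theorem map_ncH {α A B : Type*} [LinearOrder α] [Ring A] [Ring B] (f : A →+* B) (u : α → A)
    (S : Finset α) (d : ℕ) : f (ncH u S d) = ncH (fun a => f (u a)) S d := by
  simp only [ncH, map_sum, map_list_prod, List.map_map]
  rfl

/-- The alternating relation can be solved recursively for the complete functions, since `ncE u S 0`
is 1. -/
theorem IsLamFamily.ncH_mem_closure {α A : Type*} [LinearOrder α] [Ring A] {u : α → A}
    (hu : IsLamFamily u) (S : Finset α) (n : ℕ) :
    ncH u S n ∈ Subring.closure (Set.range (ncE u S)) := by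
  induction n using Nat.strong_induction_on with
  | _ n ih =>
  rcases n with _ | n
  · rw [ncH_zero]
    exact one_mem _
  have h := hu.sum_ncE_mul_ncH S n
  rw [Finset.Nat.antidiagonal_succ, Finset.sum_cons] at h
  simp only [pow_zero, ncE_zero, one_mul] at h
  rw [eq_neg_of_add_eq_zero_left h]
  refine neg_mem (sum_mem fun ij hij => ?_)
  rw [Finset.mem_map] at hij
  obtain ⟨ij, hij, rfl⟩ := hij
  rw [Finset.HasAntidiagonal.mem_antidiagonal] at hij
  refine mul_mem (pow_mem (neg_mem (one_mem _)) _)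
    (mul_mem (Subring.subset_closure ⟨_, rfl⟩) (ih _ ?_))
  simp only [Function.Embedding.prodMap, Function.Embedding.coeFn_mk, Prod.map,
    Function.Embedding.refl_apply]
  omega

open scoped IsMulCommutative in
-- Determinants need a commutative ring. The subring generated by the elementary functions is one,
-- it contains the complete functions, and the relations between both families hold in it because
-- its inclusion is injective.
theorem IsLamFamily.exists_commRing {α A : Type} [LinearOrder α] [Ring A] {u : α → A}
    (hu : IsLamFamily u) (S : Finset α) :
    ∃ (C : Type) (_ : CommRing C) (f : C →+* A) (E : ℤ → C) (H : ℕ → C),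
      (∀ d < 0, E d = 0) ∧ E 0 = 1 ∧ H 0 = 1 ∧
      (∀ n, ∑ ij ∈ Finset.HasAntidiagonal.antidiagonal (n + 1),
        (-1 : C) ^ ij.1 * (E (ij.1 : ℕ) * H ij.2) = 0) ∧
      (∀ d : ℕ, f (E d) = ncE u S d) ∧ ∀ d, f (H d) = ncH u S d := by
  have hcomm : ∀ x ∈ Set.range (ncE u S), ∀ y ∈ Set.range (ncE u S), x * y = y * x := by
    rintro _ ⟨i, rfl⟩ _ ⟨j, rfl⟩
    exact hu.ncE_commute _ S rfl i j
  let C := Subring.closure (Set.range (ncE u S))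
  have : IsMulCommutative C := Subring.isMulCommutative_closure hcomm
  refine ⟨C, inferInstance, C.subtype,
    fun d => if d < 0 then 0 else ⟨ncE u S d.toNat, Subring.subset_closure ⟨_, rfl⟩⟩,
    fun d => ⟨ncH u S d, hu.ncH_mem_closure S d⟩, fun d hd => if_pos hd, ?_, ?_, fun n => ?_,
    fun d => ?_, fun d => rfl⟩
  · exact (if_neg (lt_irrefl _)).trans (Subtype.ext (ncE_zero u S))
  · exact Subtype.ext (ncH_zero u S)
  · refine Subtype.ext ?_
    have h1 := hu.sum_ncE_mul_ncH S n
    refine Eq.trans ?_ h1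
    refine (map_sum C.subtype _ _).trans (Finset.sum_congr rfl fun ij _ => ?_)
    have h2 : ¬ ((ij.1 : ℕ) : ℤ) < 0 := by omega
    simp only [if_neg h2, Int.toNat_natCast]
    rw [map_mul, map_mul, map_pow, map_neg, map_one]
    rfl
  · have h2 : ¬ ((d : ℕ) : ℤ) < 0 := by omega
    simp only [if_neg h2, Int.toNat_natCast]
    rfl

/-! ### The quotient by Lam's relations -/

section LamQuotient

variable (k N : ℕ)

/-- The projection to the quotient by Lam's relations. -/
abbrev lamProj : NCPoly QField N →+* (lamIdeal k N).ringCon.Quotient := (lamIdeal k N).ringCon.mk'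

variable {k N}

theorem lamProj_eq_iff {x y : NCPoly QField N} : lamProj k N x = lamProj k N y ↔
    x - y ∈ lamIdeal k N := by
  rw [← TwoSidedIdeal.rel_iff]
  exact RingCon.eq _

theorem lamProj_eq_of_sub_mem {x y : NCPoly QField N} (h : x - y ∈ lamRelations k N) :
    lamProj k N x = lamProj k N y :=
  lamProj_eq_iff.2 (TwoSidedIdeal.subset_span h)

theorem uVar_mul_mul_uVar_mem (a : Fin N) (p : NCPoly QField N) :
    uVar a * p * uVar a ∈ lamIdeal k N := by
  induction p using MonoidAlgebra.induction_linear with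
  | zero =>
    rw [mul_zero, zero_mul]
    exact zero_mem _
  | add f g hf hg =>
    rw [mul_add, add_mul]
    exact add_mem hf hg
  | single w r =>
    have h : (MonoidAlgebra.single w r : NCPoly QField N) = r • monom QField w := by
      rw [monom_eq_single, MonoidAlgebra.smul_single, smul_eq_mul, mul_one]
    rw [h, mul_smul_comm, smul_mul_assoc, Algebra.smul_def, uVar, ← monom_mul, ← monom_mul]
    refine TwoSidedIdeal.mul_mem_left _ _ _ (TwoSidedIdeal.subset_span (Or.inr ⟨_, ?_, rfl⟩))
    simp [FreeMonoid.toList_mul]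

theorem isLamFamily_lamProj : IsLamFamily fun a : Fin N => lamProj k N (uVar a) where
  mul_mul_self a p := by
    obtain ⟨p, rfl⟩ := RingCon.mk'_surjective _ p
    rw [← map_mul, ← map_mul, ← map_zero (lamProj k N), lamProj_eq_iff, sub_zero]
    exact uVar_mul_mul_uVar_mem a p
  commutator a m ham := by
    have hlet : ∀ {a b : Fin N}, a < b → letter a < letter b := by
      intro a b h
      rw [Fin.lt_def] at h
      simp only [letter]
      omega
    by_cases hk : letter m - letter a > (k : ℤ)
    · left
      rw [← map_mul, ← map_mul]
      exact lamProj_eq_of_sub_mem (Or.inl (Or.inl ⟨a, m, hk, rfl⟩))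
    · right
      -- Now `m - a` is at most `k`, so `b - a` and `m - b` lie strictly between 0 and `k`. Thus `u
      -- b` commutes with `u a` and with `u m` up to opposite powers of `q`, hence exactly with both
      -- products of the two. No relation between `u a` and `u m` is used, which covers the case `m
      -- - a = k`.
      intro b hab hbm
      have h1 := hlet hab
      have h2 := hlet hbm
      set t := lamProj k N (algebraMap QField _ qq⁻¹) with ht
      set s := lamProj k N (algebraMap QField _ qq) with hs
      have hst : s * t = 1 := by
        rw [hs, ht, ← map_mul, ← map_mul, mul_inv_cancel₀ qq_ne_zero, map_one, map_one]
      have hcomm : ∀ c : Fin N, lamProj k N (uVar c) * t = t * lamProj k N (uVar c) := by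
        intro c
        rw [ht, ← map_mul, ← map_mul, Algebra.commutes]
      have hrel : ∀ c d : Fin N, 0 < letter d - letter c → letter d - letter c < (k : ℤ) →
          lamProj k N (uVar c) * lamProj k N (uVar d) =
            t * (lamProj k N (uVar d) * lamProj k N (uVar c)) := by
        intro c d h h'
        rw [ht, ← map_mul, ← map_mul, ← map_mul, ← Algebra.smul_def]
        exact lamProj_eq_of_sub_mem (Or.inl (Or.inr ⟨c, d, h, h', rfl⟩))
      have hcancel : ∀ x y, t * x = t * y → x = y := by
        intro x y h
        rw [← one_mul x, ← one_mul y, ← hst, mul_assoc, h, mul_assoc]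
      have hab' := hrel a b (by omega) (by omega)
      have hbm' := hrel b m (by omega) (by omega)
      have ha := hcomm a
      have hm := hcomm m
      generalize lamProj k N (uVar a) = ua at *
      generalize lamProj k N (uVar b) = ub at *
      generalize lamProj k N (uVar m) = um at *
      have h3 : ua * um * ub = ub * (ua * um) := by
        refine hcancel _ _ ?_
        calc t * (ua * um * ub) = t * ua * (um * ub) := by simp only [mul_assoc]
          _ = ua * (t * (um * ub)) := by rw [← ha, mul_assoc]
          _ = ua * ub * um := by rw [← hbm', mul_assoc]
          _ = t * (ub * (ua * um)) := by rw [hab']; simp only [mul_assoc]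
      have h4 : um * ua * ub = ub * (um * ua) := by
        calc um * ua * ub = um * t * (ub * ua) := by rw [mul_assoc, hab', mul_assoc]
          _ = t * (um * ub) * ua := by rw [hm]; simp only [mul_assoc]
          _ = ub * (um * ua) := by rw [← hbm', mul_assoc]
      rw [sub_mul, mul_sub, h3, h4]

theorem wordPairing_eq_of_lamProj_eq (β : Fin k → SkewShapeWithContents) {x y : NCPoly QField N}
    (h : lamProj k N x = lamProj k N y) :
    wordPairing QField N x (lltElement N β) = wordPairing QField N y (lltElement N β) := by
  have h1 := lltElement_mem_orthogonalComplement β (x - y) (lamProj_eq_iff.1 h)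
  rw [map_sub, LinearMap.sub_apply] at h1
  exact sub_eq_zero.1 h1

/-- This is `prod_H_eq_sum_kostka`, carried from the commutative ring of
`IsLamFamily.exists_commRing` to the quotient. -/
theorem lamProj_prod_ncH (m : ℕ →₀ ℕ) (p : ℕ) (hm : ∀ i, p ≤ i → m i = 0) :
    lamProj k N ((List.range p).map fun i => ncH uVar (Finset.univ : Finset (Fin N)) (m i)).prod =
      lamProj k N (∑ μ ∈ ofCard m.degree, (kostka μ m : QField) • ncSchur QField N μ) := by
  obtain ⟨C, _, f, E, H, hneg, h0, hH0, hEH, hE, hH⟩ :=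
    (isLamFamily_lamProj (k := k) (N := N)).exists_commRing Finset.univ
  have hfE : ∀ d : ℤ, lamProj k N (ncElem QField N d) = f (E d) := by
    intro d
    rcases lt_or_ge d 0 with hd | hd
    · rw [ncElem, if_pos hd, hneg d hd, map_zero, map_zero]
    · obtain ⟨d, rfl⟩ := Int.eq_ofNat_of_zero_le hd
      rw [ncElem_eq_ncE, map_ncE, hE]
  have hschur : ∀ μ : YoungDiagram, lamProj k N (ncSchur QField N μ) =
      f (eMatrix E (μ.rowLen 0) μ.colLen).det := by
    intro μ
    -- Transposing makes the Leibniz formula run over the rows, as in `ncSchur`. The product is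
    -- turned into an ordered list while still in the commutative ring.
    rw [← Matrix.det_transpose, Matrix.det_apply, ncSchur, map_sum, map_sum]
    refine Finset.sum_congr rfl fun σ _ => ?_
    rw [map_zsmul, Units.smul_def, map_zsmul, map_list_prod, List.map_ofFn, ← List.prod_ofFn,
      map_list_prod, List.map_ofFn]
    congr 3
    funext i
    exact hfE _
  rw [map_list_prod, List.map_map, map_sum]
  have h1 : ∀ μ ∈ ofCard m.degree,
      lamProj k N ((kostka μ m : QField) • ncSchur QField N μ) =
        f ((kostka μ m : C) * (eMatrix E m.degree μ.colLen).det) := by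
    intro μ hμ
    rw [mem_ofCard] at hμ
    rw [Nat.cast_smul_eq_nsmul, map_nsmul, hschur, map_mul, map_natCast, nsmul_eq_mul,
      det_eMatrix_of_le E hneg h0 ((μ.rowLen_le_card 0).trans hμ.le) _ fun i hi =>
        μ.colLen_eq_zero_of_rowLen_le hi]
  rw [Finset.sum_congr rfl h1, ← map_sum, ← prod_H_eq_sum_kostka E hneg h0 H hH0 hEH _ p m hm le_rfl]
  have h2 : ∏ i ∈ Finset.range p, H (m i) = ((List.range p).map fun i => H (m i)).prod := rfl
  rw [h2, map_list_prod, List.map_map]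
  congr 2
  funext i
  exact (map_ncH _ _ _ _).trans (hH _).symm

end LamQuotient

/-! ### Homogeneity -/

section Homogeneity

variable {N : ℕ}

/-- All words in the noncommutative polynomial `g` have length `d`. -/
def IsHomogeneousOfDegree (d : ℤ) (g : NCPoly QField N) : Prop :=
  ∀ w : Word N, (w.toList.length : ℤ) ≠ d → g.coeff w = 0

theorem IsHomogeneousOfDegree.mul {d d' : ℤ} {g g' : NCPoly QField N}
    (hg : IsHomogeneousOfDegree d g) (hg' : IsHomogeneousOfDegree d' g') :
    IsHomogeneousOfDegree (d + d') (g * g') := by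
  classical
  intro w hw
  by_contra hne
  have h1 := MonoidAlgebra.support_coeff_mul_subset g g' (Finsupp.mem_support_iff.2 hne)
  obtain ⟨x, hx, y, hy, rfl⟩ := Finset.mem_mul.1 h1
  rw [Finsupp.mem_support_iff] at hx hy
  have h2 : (x.toList.length : ℤ) = d := by
    by_contra h
    exact hx (hg x h)
  have h3 : (y.toList.length : ℤ) = d' := by
    by_contra h
    exact hy (hg' y h)
  rw [FreeMonoid.toList_mul, List.length_append] at hw
  push_cast at hw
  exact hw (by rw [h2, h3])

theorem IsHomogeneousOfDegree.sum {ι : Type*} {d : ℤ} (s : Finset ι) (g : ι → NCPoly QField N)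
    (h : ∀ i ∈ s, IsHomogeneousOfDegree d (g i)) : IsHomogeneousOfDegree d (∑ i ∈ s, g i) := by
  intro w hw
  rw [MonoidAlgebra.coeff_sum, Finsupp.finsetSum_apply]
  exact Finset.sum_eq_zero fun i hi => h i hi w hw

theorem isHomogeneousOfDegree_monom (w : Word N) :
    IsHomogeneousOfDegree (w.toList.length : ℤ) (monom QField w) := by
  classical
  intro v hv
  rw [coeff_monom, if_neg]
  rintro rfl
  exact hv rfl

theorem isHomogeneousOfDegree_ncElem (d : ℤ) : IsHomogeneousOfDegree d (ncElem QField N d) := by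
  rw [ncElem]
  split_ifs with hd
  · exact fun w _ => rfl
  · refine IsHomogeneousOfDegree.sum _ _ fun S hS => ?_
    have h := isHomogeneousOfDegree_monom (FreeMonoid.ofList (S.sort (· ≥ ·)))
    rw [FreeMonoid.toList_ofList, Finset.length_sort, (Finset.mem_powersetCard.1 hS).2,
      Int.toNat_of_nonneg (not_lt.1 hd)] at h
    exact h

theorem IsHomogeneousOfDegree.prod_ofFn {n : ℕ} (d : Fin n → ℤ) (g : Fin n → NCPoly QField N)
    (h : ∀ i, IsHomogeneousOfDegree (d i) (g i)) :
    IsHomogeneousOfDegree (∑ i, d i) (List.ofFn g).prod := by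
  induction n with
  | zero =>
    rw [List.ofFn_zero, List.prod_nil, Finset.univ_eq_empty, Finset.sum_empty]
    exact isHomogeneousOfDegree_monom (1 : Word N)
  | succ n ih =>
    rw [List.ofFn_succ, List.prod_cons, Fin.sum_univ_succ]
    exact (h 0).mul (ih _ _ fun i => h i.succ)

/-- The shifts `p i - i` cancel in the sum over `i`, so every term of the Jacobi–Trudi formula has
the same degree. This makes the family of Schur coefficients finitely supported. -/
theorem isHomogeneousOfDegree_ncSchur (lam : YoungDiagram) :
    IsHomogeneousOfDegree (lam.card : ℤ) (ncSchur QField N lam) := by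
  refine IsHomogeneousOfDegree.sum _ _ fun p _ => ?_
  have h1 := IsHomogeneousOfDegree.prod_ofFn
    (fun i : Fin (lam.rowLen 0) => (lam.colLen (i : ℕ) : ℤ) + ((p i : ℕ) : ℤ) - ((i : ℕ) : ℤ))
    (fun i => ncElem QField N _) fun i => isHomogeneousOfDegree_ncElem _
  have h2 : ∑ i : Fin (lam.rowLen 0),
      ((lam.colLen (i : ℕ) : ℤ) + ((p i : ℕ) : ℤ) - ((i : ℕ) : ℤ)) = lam.card := by
    rw [Finset.sum_sub_distrib, Finset.sum_add_distrib,
      Equiv.sum_comp p fun i : Fin (lam.rowLen 0) => ((i : ℕ) : ℤ), add_sub_cancel_right,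
      lam.card_eq_sum_colLen le_rfl, ← Fin.sum_univ_eq_sum_range]
    push_cast
    rfl
  rw [h2] at h1
  intro w hw
  rw [MonoidAlgebra.coeff_smul, Finsupp.smul_apply, h1 w hw, smul_zero]

end Homogeneity

/-! ### The Schur expansion -/

section SchurExpansion

variable {N k : ℕ} (β : Fin k → SkewShapeWithContents)

theorem length_of_mem_lltWords {v : Word N} (hv : v ∈ lltWords N β) :
    v.toList.length = Multiset.card (shiftedContents β) := by
  rw [← ((mem_lltWords β).1 hv).2.1, Multiset.coe_card, List.length_map]

theorem wordPairing_ncSchur_eq_zero (lam : YoungDiagram)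
    (h : lam.card ≠ Multiset.card (shiftedContents β)) :
    wordPairing QField N (ncSchur QField N lam) (lltElement N β) = 0 := by
  rw [wordPairing_lltElement]
  refine Finset.sum_eq_zero fun v hv => ?_
  rw [isHomogeneousOfDegree_ncSchur lam v, mul_zero]
  rw [length_of_mem_lltWords β hv]
  exact_mod_cast h.symm

/-- The coefficient is the pairing of a product of complete functions with `lltElement`; since the
latter is orthogonal to the ideal, that product may be replaced by its Schur expansion modulo the
ideal. -/
theorem lltPoly_apply (m : ℕ →₀ ℕ) : lltPoly N β m = ∑ μ ∈ ofCard m.degree,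
    (kostka μ m : QField) * wordPairing QField N (ncSchur QField N μ) (lltElement N β) := by
  classical
  obtain ⟨p, hp⟩ := exists_bound m
  have h1 := wordPairing_eq_of_lamProj_eq β (lamProj_prod_ncH (k := k) (N := N) m p hp)
  rw [map_sum, LinearMap.sum_apply] at h1
  simp only [map_smul, LinearMap.smul_apply, smul_eq_mul] at h1
  rw [← h1, wordPairing_lltElement]
  have h2 : lltPoly N β m = ∑ v ∈ lltWords N β, qq ^ kInv k v * wordQSym QField v m :=
    Finset.sum_apply m (lltWords N β) fun v => qq ^ kInv k v • wordQSym QField v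
  rw [h2]
  refine Finset.sum_congr rfl fun v hv => ?_
  rw [wordQSym_apply v ((mem_lltWords β).1 hv).1 m p hp, ← coeff_prod_ncH, FreeMonoid.ofList_toList]

theorem genFun_lltElement : genFun QField N (lltElement N β) = lltPoly N β := by
  rw [lltElement, lltPoly, map_sum]
  refine Finset.sum_congr rfl fun v _ => ?_
  rw [map_smul]
  congr 1
  have h : genFun QField N (monom QField v) =
      Finsupp.linearCombination QField (fun w : Word N => wordQSym QField w)
        (Finsupp.single v 1) := rfl
  rw [h, Finsupp.linearCombination_single, one_smul]

/-- The pairings of the noncommutative Schur functions with the LLT element. -/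
def schurPairings (N : ℕ) {k : ℕ} (β : Fin k → SkewShapeWithContents) : YoungDiagram →₀ QField :=
  Finsupp.onFinset (ofCard (Multiset.card (shiftedContents β)))
    (fun lam => wordPairing QField N (ncSchur QField N lam) (lltElement N β)) fun lam h => by
      rw [mem_ofCard]
      by_contra hne
      exact h (wordPairing_ncSchur_eq_zero β lam hne)

theorem isQLRFamily_schurPairings : IsQLRFamily N β (schurPairings N β) := by
  classical
  funext m
  -- One sum runs over the support of the pairings, the other over the shapes of size `m.degree`.
  -- Both are extended to the union; the extra terms vanish through the Kostka number or through the
  -- pairing.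
  rw [sum_smul_schurFun_apply, lltPoly_apply, Finsupp.sum,
    Finset.sum_subset
      (Finset.subset_union_left (s₁ := (schurPairings N β).support) (s₂ := ofCard m.degree)),
    ← Finset.sum_subset
      (Finset.subset_union_right (s₁ := (schurPairings N β).support) (s₂ := ofCard m.degree))]
  · exact Finset.sum_congr rfl fun μ _ => mul_comm _ _
  · intro μ _ hμ
    rw [mem_ofCard] at hμ
    rw [kostka_eq_zero_of_degree_ne (Ne.symm hμ), Nat.cast_zero, mul_zero]
  · intro μ _ hμ
    rw [Finsupp.notMem_support_iff.1 hμ, zero_mul]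

theorem IsQLRFamily.eq_schurPairings {c : YoungDiagram →₀ QField} (hc : IsQLRFamily N β c) :
    c = schurPairings N β :=
  sum_smul_schurFun_injective _ _ (hc.symm.trans (isQLRFamily_schurPairings β))

end SchurExpansion

end

theorem propositionp (k N : ℕ) (β : Fin k → SkewShapeWithContents) (hβ : Admissible N β) :
    lltElement N β ∈ orthogonalComplement (lamIdeal k N) ∧
    lltPoly N β = genFun QField N (lltElement N β) ∧
    (∃! c : YoungDiagram →₀ QField, IsQLRFamily N β c) ∧
    ∀ c : YoungDiagram →₀ QField, IsQLRFamily N β c →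
      ∀ lam : YoungDiagram, c lam = wordPairing QField N (ncSchur QField N lam) (lltElement N β) := by
  refine ⟨lltElement_mem_orthogonalComplement β, (genFun_lltElement β).symm,
    ⟨schurPairings N β, isQLRFamily_schurPairings β, fun c hc => hc.eq_schurPairings β⟩, ?_⟩
  rintro c hc lam
  rw [hc.eq_schurPairings β]
  rfl
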